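/- Let $\mathcal I$ be a nonempty countable set of states and $M=(m_{ij})_{i,j\in\mathcal I}$ a $0$-$1$ matrix. Let $\Sigma_M=\{x\in\mathcal I^{\mathbb N}: m_{x_nx_{n+1}}=1 \text{ for all } n\ge 0\}$, with the topology induced by the product of the discrete topologies, let $\sigma$ be the left shift on $\Sigma_M$, and write $[i]=\{x\in\Sigma_M: x_0=i\}$. Assume that $\sigma$ is topologically transitive and that every $[i]$ is nonempty (together these say that $M$ is irreducible), and that all column sums $c_j=\sum_i m_{ij}$ are finite. Let $Q$ be the stochastic matrix with entries $q_{ji}=m_{ij}/c_j$. A state $i$ is recurrent for $Q$ if the chain with transition matrix $Q$ started at $i$ returns to $i$ with probability $1$, and is then positive or null recurrent according to whether its mean return time is finite or infinite; otherwise it is transient. $Q$ is called positive recurrent, null recurrent or transient if all its states are. For $y_0\in\Sigma_M$, a random backward trajectory of $y_0$ is a Markov chain $(y_n)_{n\ge0}$ in $\Sigma_M$ that starts at $y_0$ and moves from a point $x$ to each of its finitely many preimages $z\in\sigma^{-1}(x)$ with probability $1/\#\sigma^{-1}(x)$. A $\sigma$-invariant Borel probability measure $\mu$ on $\Sigma_M$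 is fair if for every Borel set $B$ which, for each $i$, is contained in or disjoint from $\sigma([i])$, we have $\mu([i]\cap\sigma^{-1}(B))=\mu(B)/\#\{j: B\subset\sigma([j])\}$ for all $i$ with $B\subset\sigma([i])$. Then every $y_0\in\Sigma_M$ has a random backward trajectory, and the following hold. (a) If $Q$ is positive recurrent, then there is exactly one probability vector $\pi$ with $\pi Q=\pi$, all its entries are positive, the matrix $P$ given by $\pi_ip_{ij}=\pi_jq_{ji}$ is stochastic, and there is a Borel probability measure $\mu=\mathrm{Markov}(\pi,P)$ on $\Sigma_M$, that is, $\mu(\{x: x_0=w_0,\dots,x_m=w_m\})=\pi_{w_0}p_{w_0w_1}\cdots p_{w_{m-1}w_m}$ for all $m\ge0$ and $w_0,\dots,w_m\in\mathcal I$. This $\mu$ is fair, and for every $y_0\in\Sigma_M$, almost surely the random backward trajectory $(y_n)$ of $y_0$ equidistributes for $\mu$: $\frac1N\sum_{n=0}^{N-1}\varphi(y_n)\to\int\varphi\,d\mu$ as $N\to\infty$ for all bounded continuous $\varphi:\Sigma_M\to\mathbb R$. (b) If $Q$ is null recurrent, then for every $y_0\in\Sigma_M$, almost surely $(y_n)$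 is dense in $\Sigma_M$ and $\frac1N\#\{0\le n<N: y_n\in[i]\}\to0$ as $N\to\infty$ for every $i\in\mathcal I$. (c) If $Q$ is transient, then for every $y_0\in\Sigma_M$, almost surely $(y_n)$ visits each $[i]$, $i\in\mathcal I$, only finitely often. -/

import Mathlib

open MeasureTheory Filter Topology
open scoped ENNReal BoundedContinuousFunction

namespace CMS

section Dynamics

/-- Topological transitivity of a map: every nonempty open set can be moved by an iterate so as to
meet any other nonempty open set. -/
def IsTransitive {X : Type*} [TopologicalSpace X] (f : X → X) : Prop :=
  ∀ U V : Set X, IsOpen U → U.Nonempty → IsOpen V → V.Nonempty →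
    ∃ n : ℕ, ((f^[n] '' U) ∩ V).Nonempty

/-- Fair measures of `f : X → X`, where `A` is a countable measurable partition of `X` into sets on
which `f` is injective. A set `B` lies in one element of the common refinement of the partitions
`{f (A i), X \ f (A i)}` when, for each `i`, it is contained in or disjoint from `f (A i)`. The
branches defined on `B` are those `i` with `B ⊆ f (A i)`, and the measure of `B` is shared equally
among the corresponding pieces of its preimage. -/
structure IsFairMeasure {X ι : Type*} [MeasurableSpace X] (f : X → X) (A : ι → Set X)
    (μ : Measure X) : Prop where
  isProbabilityMeasure : IsProbabilityMeasure μ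
  invariant : MeasurePreserving f μ μ
  fair : ∀ B : Set X, MeasurableSet B →
    (∀ i, B ⊆ f '' A i ∨ Disjoint B (f '' A i)) →
      ∀ i, B ⊆ f '' A i →
        μ (A i ∩ f ⁻¹' B) = μ B / ENat.toENNReal ({j | B ⊆ f '' A j} : Set ι).encard

/-- The probability of moving backward from `x` to `z`: it is `1 / c(x)` for each of the `c(x)`
preimages `z` of `x`, and `0` for all other points. -/
noncomputable def backwardProb {X : Type*} (f : X → X) (x z : X) : ℝ≥0∞ :=
  Set.indicator (f ⁻¹' {x}) (fun _ => (ENat.toENNReal (f ⁻¹' {x}).encard)⁻¹) z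

/-- `Y 0, Y 1, …` is a Markov chain, defined on the probability space `(Ω, ℙ)`, that starts at `y₀`
and has transition probabilities `backwardProb f`. -/
structure IsRandomBackwardTrajectory {X Ω : Type*} [MeasurableSpace X] [MeasurableSpace Ω]
    (f : X → X) (y₀ : X) (ℙ : Measure Ω) (Y : ℕ → Ω → X) : Prop where
  isProbabilityMeasure : IsProbabilityMeasure ℙ
  measurable : ∀ n, Measurable (Y n)
  initial : ℙ {ω | Y 0 ω = y₀} = 1
  transition : ∀ (n : ℕ) (x : ℕ → X),
    ℙ {ω | ∀ k ≤ n + 1, Y k ω = x k} =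
      ℙ {ω | ∀ k ≤ n, Y k ω = x k} * backwardProb f (x n) (x (n + 1))

/-- The measure `(1 / N) ∑_{n < N} δ_{y n}`. -/
noncomputable def empiricalMeasure {X : Type*} [MeasurableSpace X] (y : ℕ → X) (N : ℕ) :
    Measure X :=
  (N : ℝ≥0∞)⁻¹ • ∑ n ∈ Finset.range N, Measure.dirac (y n)

/-- The empirical measures of the sequence `y` converge to `μ` against all bounded continuous
functions. -/
def Equidistributes {X : Type*} [TopologicalSpace X] [MeasurableSpace X] (y : ℕ → X)
    (μ : Measure X) : Prop :=
  ∀ φ : X →ᵇ ℝ, Tendsto (fun N : ℕ => ∫ x, φ x ∂(empiricalMeasure y N)) atTop (𝓝 (∫ x, φ x ∂μ))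

open Classical in
/-- The sequence `y` visits the set `C` with limiting frequency `a`. -/
def HasLimitingFrequency {X : Type*} (y : ℕ → X) (C : Set X) (a : ℝ) : Prop :=
  Tendsto (fun N : ℕ => (((Finset.range N).filter (fun n => y n ∈ C)).card : ℝ) / N) atTop (𝓝 a)

end Dynamics

section Chains

variable {I : Type*}

open Classical in
/-- `firstPassage Q j n i` is the probability that the chain with transition matrix `Q` started at
`i` is in state `j` at time `n` for the first time after time `0`. -/
noncomputable def firstPassage (Q : Matrix I I ℝ≥0∞) (j : I) : ℕ → I → ℝ≥0∞
  | 0, _ => 0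
  | 1, i => Q i j
  | n + 2, i => ∑' k, if k = j then 0 else Q i k * firstPassage Q j (n + 1) k

/-- The probability that the chain started at `i` ever returns to `i`. -/
noncomputable def returnProb (Q : Matrix I I ℝ≥0∞) (i : I) : ℝ≥0∞ :=
  ∑' n, firstPassage Q i n i

/-- The mean recurrence time of the state `i`. -/
noncomputable def meanReturnTime (Q : Matrix I I ℝ≥0∞) (i : I) : ℝ≥0∞ :=
  ∑' n : ℕ, (n : ℝ≥0∞) * firstPassage Q i n i

def IsPositiveRecurrent (Q : Matrix I I ℝ≥0∞) : Prop :=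
  ∀ i, returnProb Q i = 1 ∧ meanReturnTime Q i < ∞

def IsNullRecurrent (Q : Matrix I I ℝ≥0∞) : Prop :=
  ∀ i, returnProb Q i = 1 ∧ meanReturnTime Q i = ∞

def IsTransient (Q : Matrix I I ℝ≥0∞) : Prop :=
  ∀ i, returnProb Q i < 1

/-- `π` is a probability vector with `π Q = π`. -/
def IsStationaryVector (π : I → ℝ≥0∞) (Q : Matrix I I ℝ≥0∞) : Prop :=
  ∑' i, π i = 1 ∧ ∀ i, ∑' j, π j * Q j i = π i

end Chains

section Shift

variable {I : Type*}

/-- The one-sided Markov shift space of the 0-1 matrix `M`, with the subspace topology and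
σ-algebra of the product `ℕ → I`. -/
abbrev ShiftSpace (M : Matrix I I ℕ) : Type _ :=
  {x : ℕ → I // ∀ n, M (x n) (x (n + 1)) = 1}

/-- The left shift. -/
def shift (M : Matrix I I ℕ) (x : ShiftSpace M) : ShiftSpace M :=
  ⟨fun n => x.1 (n + 1), fun n => x.2 (n + 1)⟩

/-- The 1-cylinder `[i]`. -/
def oneCylinder (M : Matrix I I ℕ) (i : I) : Set (ShiftSpace M) :=
  {x | x.1 0 = i}

/-- The column sum `c_j = ∑_i m_{ij}`, possibly infinite. -/
noncomputable def colSum (M : Matrix I I ℕ) (j : I) : ℝ≥0∞ :=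
  ∑' i, (M i j : ℝ≥0∞)

/-- The matrix `Q` with entries `q_{ji} = m_{ij} / c_j`. -/
noncomputable def backwardMatrix (M : Matrix I I ℕ) : Matrix I I ℝ≥0∞ :=
  fun j i => (M i j : ℝ≥0∞) / colSum M j

/-- `μ` is the measure `Markov(π, P)` on the shift space, given by its values
`μ [w_0 ⋯ w_m] = π_{w_0} p_{w_0 w_1} ⋯ p_{w_{m-1} w_m}` on cylinder sets. -/
def IsMarkovMeasure [MeasurableSpace I] (M : Matrix I I ℕ) (μ : Measure (ShiftSpace M))
    (π : I → ℝ≥0∞) (P : Matrix I I ℝ≥0∞) : Prop :=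
  ∀ (m : ℕ) (w : ℕ → I),
    μ {x | ∀ k ≤ m, x.1 k = w k} = π (w 0) * ∏ k ∈ Finset.range m, P (w k) (w (k + 1))

end Shift

end CMS

open CMS

/-!
The symbols `X n = (Y n) 0` of a random backward trajectory form a Markov chain with transition
matrix `Q = backwardMatrix M`, and almost surely `Y n` is the sequence `X n, X (n - 1), …, X 0`
followed by the tail of the starting point (`ae_eq_glue`). Everything is therefore a question about
how often the chain `X` reads a given word backward.

*Transience.* The expected number of visits to a state is finite (`greenSum_bounded`), so
Borel-Cantelli applies.

*Recurrence.* By irreducibility every state is hit almost surely from every other one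
(`hitProb_eq_one`), hence visited infinitely often, and Lévy's extension of Borel-Cantelli upgrades
this from states to words (`IsMarkovChain.ae_frequently_word`). This is density.

*Frequencies.* The centred indicators of the event that a given word is followed by a given letter
are bounded and orthogonal, so their averages tend to zero almost surely
(`IsMarkovChain.ae_tendsto_average`). For one-letter words this says that every limit point of the
frequencies of the states is a subinvariant vector of mass at most one
(`subinvariant_of_ultrafilter`). Subinvariant vectors of an irreducible recurrent matrix are
multiples of the excursion measure (`eq_mul_excursion`), whose mass is the mean return time
(`tsum_excursion`). In the null recurrent case this mass is infinite, so the only limit point is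
zero. In the positive recurrent case the limit is a multiple `c π` of the stationary vector with
`c ≤ 1`, and it remains to exclude a loss of mass at infinity. The maximal ergodic inequality for
the stationary chain shows that almost surely the chain spends little time outside a large finite set
(`IsMarkovChain.ae_exists_finset`), so `c = 1`. The frequencies of longer words follow one letter at
a time (`tendsto_avg_hasWord`), and they are the measures of the cylinder sets for the
Markov measure of the time-reversed matrix `P`. Convergence on the π-system of cylinder sets implies
equidistribution.

*The measure.* Trajectories and the Markov measure are obtained from the Ionescu-Tulcea theorem.
Fairness and invariance both come from the identity `μ([i] ∩ σ⁻¹ B) = q_{ki} μ(B)` for `B ⊆ [k]`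
(`IsMarkovMeasure.measure_branch`), which holds on cylinder sets because `π i p_{ij} = π j q_{ji}`.
-/

open CMS

namespace CMS

/-! ### First passages, Green sums and invariant vectors of a stochastic matrix -/

section MatrixTheory

variable {I : Type*} {Q : Matrix I I ℝ≥0∞}

/-- All row sums are `1`. -/
def IsStochastic (Q : Matrix I I ℝ≥0∞) : Prop := ∀ x, ∑' y, Q x y = 1

lemma IsStochastic.le_one (hQ : IsStochastic Q) (x y : I) : Q x y ≤ 1 := by
  rw [← hQ x]; exact ENNReal.le_tsum y

lemma IsStochastic.ne_top (hQ : IsStochastic Q) (x y : I) : Q x y ≠ ∞ :=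
  ne_top_of_le_ne_top ENNReal.one_ne_top (hQ.le_one x y)

lemma IsStationaryVector.ne_top {π : I → ℝ≥0∞} (hπ : IsStationaryVector π Q)
    (i : I) : π i ≠ ∞ :=
  ne_top_of_le_ne_top ENNReal.one_ne_top (by rw [← hπ.1]; exact ENNReal.le_tsum i)

/-- Any state leads to any other one along transitions of positive probability. -/
def IsIrreducibleChain (Q : Matrix I I ℝ≥0∞) : Prop :=
  ∀ x y, Relation.ReflTransGen (fun a b => 0 < Q a b) x y

/-- The probability that the chain started at `x` visits `j` at some time after time `0`. -/
noncomputable def hitProb (Q : Matrix I I ℝ≥0∞) (j x : I) : ℝ≥0∞ :=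
  ∑' n, firstPassage Q j n x

open Classical in
/-- The matrix `Q` with the transitions into `j` removed. -/
noncomputable def avoid (Q : Matrix I I ℝ≥0∞) (j : I) : Matrix I I ℝ≥0∞ :=
  fun x k => if k = j then 0 else Q x k

lemma avoid_self (Q : Matrix I I ℝ≥0∞) (j x : I) : avoid Q j x j = 0 := by simp [avoid]

lemma avoid_of_ne {j k : I} (h : k ≠ j) (x : I) : avoid Q j x k = Q x k := by simp [avoid, h]

lemma tsum_mul_eq_add_avoid (Q : Matrix I I ℝ≥0∞) (j x : I) (f : I → ℝ≥0∞) :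
    ∑' k, Q x k * f k = Q x j * f j + ∑' k, avoid Q j x k * f k := by
  classical
  rw [ENNReal.tsum_eq_add_tsum_ite j]
  congr 1
  refine tsum_congr fun k => ?_
  by_cases h : k = j <;> simp [avoid, h]

lemma tsum_eq_add_avoid (Q : Matrix I I ℝ≥0∞) (j x : I) :
    ∑' k, Q x k = Q x j + ∑' k, avoid Q j x k := by
  simpa using tsum_mul_eq_add_avoid Q j x (fun _ => 1)

lemma firstPassage_zero (j x : I) : firstPassage Q j 0 x = 0 := rfl

lemma firstPassage_one (j x : I) : firstPassage Q j 1 x = Q x j := rfl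

lemma firstPassage_succ_succ (j : I) (n : ℕ) (x : I) :
    firstPassage Q j (n + 2) x = ∑' k, avoid Q j x k * firstPassage Q j (n + 1) k := by
  rw [firstPassage]
  refine tsum_congr fun k => ?_
  by_cases h : k = j <;> simp [avoid, h]

lemma hitProb_eq_tsum_succ (j x : I) : hitProb Q j x = ∑' n, firstPassage Q j (n + 1) x := by
  rw [hitProb, tsum_eq_zero_add' ENNReal.summable, firstPassage_zero, zero_add]

/-- First step analysis. -/
lemma hitProb_eq (j x : I) :
    hitProb Q j x = Q x j + ∑' k, avoid Q j x k * hitProb Q j k := by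
  rw [hitProb_eq_tsum_succ, tsum_eq_zero_add' ENNReal.summable, zero_add, firstPassage_one]
  congr 1
  simp_rw [firstPassage_succ_succ, hitProb_eq_tsum_succ, ← ENNReal.tsum_mul_left]
  exact ENNReal.tsum_comm

lemma sum_firstPassage_le_one (hQ : IsStochastic Q) (j : I) (N : ℕ) (x : I) :
    ∑ n ∈ Finset.range N, firstPassage Q j (n + 1) x ≤ 1 := by
  induction N generalizing x with
  | zero => simp
  | succ N ih =>
    rw [Finset.sum_range_succ', zero_add, firstPassage_one]
    simp_rw [firstPassage_succ_succ]
    rw [← Summable.tsum_finsetSum (fun _ _ => ENNReal.summable)]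
    simp_rw [← Finset.mul_sum]
    calc _ ≤ ∑' k, avoid Q j x k * 1 + Q x j := by
          gcongr with k
          exact ih k
      _ = 1 := by simp only [mul_one]; rw [add_comm, ← tsum_eq_add_avoid, hQ x]

lemma hitProb_le_one (hQ : IsStochastic Q) (j x : I) : hitProb Q j x ≤ 1 := by
  rw [hitProb_eq_tsum_succ]
  exact ENNReal.tsum_le_of_sum_range_le fun N => sum_firstPassage_le_one hQ j N x

/-- If the chain returns to `j` almost surely, then `hitProb Q j` is harmonic at every state and
takes its maximum `1` at `j`, so that the value `1` spreads along transitions. -/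
lemma hitProb_eq_one (hQ : IsStochastic Q) (hirr : IsIrreducibleChain Q) {j : I}
    (hj : hitProb Q j j = 1) (x : I) : hitProb Q j x = 1 := by
  have harm : ∀ x, hitProb Q j x = ∑' k, Q x k * hitProb Q j k := fun x => by
    rw [tsum_mul_eq_add_avoid Q j x, hj, mul_one, ← hitProb_eq]
  induction hirr j x with
  | refl => exact hj
  | @tail b c _ hbc ih =>
    by_contra hc
    have hlt : hitProb Q j c < 1 := lt_of_le_of_ne (hitProb_le_one hQ j c) hc
    have hfin : Q b c ≠ ∞ := hQ.ne_top b c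
    have h1 : ∑' k, Q b k * hitProb Q j k < ∑' k, Q b k := by
      refine ENNReal.tsum_lt_tsum (i := c) ?_ ?_ ?_
      · rw [← harm, ih]; exact ENNReal.one_ne_top
      · exact fun k => mul_le_of_le_one_right' (hitProb_le_one hQ j k)
      · simpa using ENNReal.mul_lt_mul_right hbc.ne' hfin hlt
    rw [← harm, ih, hQ b] at h1
    exact lt_irrefl _ h1

open Classical in
/-- The expected number of visits to `j` before time `N` of the chain started at `x`. -/
noncomputable def greenSum (Q : Matrix I I ℝ≥0∞) (j : I) : ℕ → I → ℝ≥0∞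
  | 0, _ => 0
  | N + 1, x => (if x = j then 1 else 0) + ∑' y, Q x y * greenSum Q j N y

lemma greenSum_mono (j : I) (N : ℕ) (x : I) : greenSum Q j N x ≤ greenSum Q j (N + 1) x := by
  induction N generalizing x with
  | zero => exact zero_le
  | succ N ih =>
    rw [greenSum, greenSum]
    gcongr with k
    exact ih k

lemma greenSum_le_nat (hQ : IsStochastic Q) (j : I) (N : ℕ) (x : I) : greenSum Q j N x ≤ N := by
  induction N generalizing x with
  | zero => simp [greenSum]
  | succ N ih =>
    rw [greenSum]
    calc _ ≤ 1 + ∑' y, Q x y * N := by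
          gcongr with y
          · split_ifs <;> simp
          · exact ih y
      _ = (N + 1 : ℕ) := by rw [ENNReal.tsum_mul_right, hQ x]; push_cast; ring

open Classical in
/-- After time `0`, visits are counted only from the first one on, where the chain starts afresh at
`j`. The truncated sums are finite, so that the case `x = j` can be solved for `greenSum Q j N j`. -/
lemma greenSum_le (j : I) (N : ℕ) (x : I) :
    greenSum Q j N x ≤ (if x = j then 1 else 0) + hitProb Q j x * greenSum Q j N j := by
  induction N generalizing x with
  | zero => simp [greenSum]
  | succ N ih =>
    have hN := greenSum_mono (Q := Q) j N j
    rw [greenSum, tsum_mul_eq_add_avoid Q j x]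
    refine add_le_add le_rfl ?_
    calc _ ≤ Q x j * greenSum Q j N j
          + ∑' k, avoid Q j x k * (hitProb Q j k * greenSum Q j N j) := by
          refine add_le_add le_rfl (ENNReal.tsum_le_tsum fun k => ?_)
          by_cases hk : k = j
          · rw [hk, avoid_self, zero_mul, zero_mul]
          · gcongr
            simpa [hk] using ih k
      _ = hitProb Q j x * greenSum Q j N j := by
          conv_rhs => rw [hitProb_eq, add_mul, ← ENNReal.tsum_mul_right]
          simp_rw [mul_assoc]
      _ ≤ _ := by gcongr

lemma greenSum_bounded (hQ : IsStochastic Q) {j : I} (hj : hitProb Q j j < 1) :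
    ∃ C : ℝ≥0∞, C ≠ ∞ ∧ ∀ N x, greenSum Q j N x ≤ C := by
  have hpos : 1 - hitProb Q j j ≠ 0 := (tsub_pos_of_lt hj).ne'
  have h1 : ∀ N, greenSum Q j N j ≤ (1 - hitProb Q j j)⁻¹ := fun N => by
    have h := greenSum_le (Q := Q) j N j
    have hfin : greenSum Q j N j ≠ ∞ :=
      ne_top_of_le_ne_top (ENNReal.natCast_ne_top N) (greenSum_le_nat hQ j N j)
    rw [← one_div, ENNReal.le_div_iff_mul_le (Or.inl hpos) (Or.inl (by finiteness)),
      ENNReal.mul_sub (fun _ _ => hfin), mul_one, tsub_le_iff_right]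
    simpa [mul_comm] using h
  refine ⟨1 + (1 - hitProb Q j j)⁻¹, by finiteness, fun N x => ?_⟩
  calc greenSum Q j N x ≤ _ := greenSum_le j N x
    _ ≤ 1 + 1 * (1 - hitProb Q j j)⁻¹ := by
      gcongr
      · split_ifs <;> simp
      · exact hitProb_le_one hQ j x
      · exact h1 N
    _ = _ := by rw [one_mul]

open Classical in
/-- The probability that the chain started at `a` is at `y` at time `n` and has not returned to `a`
up to that time. -/
noncomputable def taboo (Q : Matrix I I ℝ≥0∞) (a : I) : ℕ → I → ℝ≥0∞
  | 0, y => if y = a then 1 else 0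
  | n + 1, y => ∑' x, taboo Q a n x * avoid Q a x y

/-- The expected number of visits to `y` during an excursion from `a`. -/
noncomputable def excursion (Q : Matrix I I ℝ≥0∞) (a y : I) : ℝ≥0∞ := ∑' n, taboo Q a n y

lemma taboo_zero_self (a : I) : taboo Q a 0 a = 1 := by simp [taboo]

lemma taboo_succ_self (a : I) (n : ℕ) : taboo Q a (n + 1) a = 0 := by
  simp [taboo, avoid_self]

lemma tsum_taboo_mul_firstPassage (a : I) (n k : ℕ) :
    ∑' x, taboo Q a n x * firstPassage Q a (k + 1) x = firstPassage Q a (n + k + 1) a := by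
  induction n generalizing k with
  | zero =>
    rw [tsum_eq_single a]
    · simp [taboo]
    · intro b hb; simp [taboo, hb]
  | succ n ih =>
    simp_rw [taboo, ← ENNReal.tsum_mul_right]
    rw [ENNReal.tsum_comm]
    simp_rw [mul_assoc, ENNReal.tsum_mul_left, ← firstPassage_succ_succ]
    rw [show n + 1 + k + 1 = n + (k + 1) + 1 by ring, ← ih (k + 1)]

lemma tsum_taboo_succ (hQ : IsStochastic Q) (a : I) (n : ℕ) :
    ∑' y, taboo Q a (n + 1) y + firstPassage Q a (n + 1) a = ∑' y, taboo Q a n y := by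
  have h := tsum_taboo_mul_firstPassage (Q := Q) a n 0
  rw [add_zero, zero_add] at h
  simp_rw [firstPassage_one] at h
  rw [← h]
  simp_rw [taboo]
  rw [ENNReal.tsum_comm]
  simp_rw [ENNReal.tsum_mul_left]
  rw [← ENNReal.tsum_add]
  refine tsum_congr fun x => ?_
  rw [← mul_add, add_comm, ← tsum_eq_add_avoid, hQ x, mul_one]

lemma tsum_taboo_add_sum (hQ : IsStochastic Q) (a : I) (n : ℕ) :
    ∑' y, taboo Q a n y + ∑ k ∈ Finset.range n, firstPassage Q a (k + 1) a = 1 := by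
  induction n with
  | zero =>
    rw [tsum_eq_single a]
    · simp [taboo]
    · intro b hb; simp [taboo, hb]
  | succ n ih =>
    rw [Finset.sum_range_succ, ← ih, ← tsum_taboo_succ hQ a n]
    ring

/-- The probability that the first return takes place after time `n`. -/
lemma tsum_taboo_eq (hQ : IsStochastic Q) {a : I} (ha : hitProb Q a a = 1) (n : ℕ) :
    ∑' y, taboo Q a n y = ∑' k, firstPassage Q a (n + k + 1) a := by
  have h1 := tsum_taboo_add_sum hQ a n
  have h2 : ∑' k, firstPassage Q a (n + k + 1) a
      + ∑ k ∈ Finset.range n, firstPassage Q a (k + 1) a = 1 := by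
    rw [← ha, hitProb_eq_tsum_succ, ← ENNReal.summable.sum_add_tsum_nat_add'
      (f := fun k => firstPassage Q a (k + 1) a) (k := n), add_comm]
    simp_rw [add_comm n]
  have hfin : ∑ k ∈ Finset.range n, firstPassage Q a (k + 1) a ≠ ∞ :=
    ne_top_of_le_ne_top ENNReal.one_ne_top (sum_firstPassage_le_one hQ a n a)
  exact (ENNReal.add_left_inj hfin).1 (h1.trans h2.symm)

lemma excursion_self (a : I) : excursion Q a a = 1 := by
  rw [excursion, tsum_eq_zero_add' ENNReal.summable]
  simp [taboo_zero_self, taboo_succ_self]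

/-- The mass of the excursion measure is the mean length of an excursion. -/
lemma tsum_excursion (hQ : IsStochastic Q) {a : I} (ha : hitProb Q a a = 1) :
    ∑' y, excursion Q a y = meanReturnTime Q a := by
  classical
  simp_rw [excursion]
  rw [ENNReal.tsum_comm]
  simp_rw [tsum_taboo_eq hQ ha]
  -- Both sides are the sum of `firstPassage Q a m a` over all pairs `n < m`.
  have h1 : ∀ n, ∑' k, firstPassage Q a (n + k + 1) a
      = ∑' m, if n < m then firstPassage Q a m a else 0 := fun n => by
    rw [← ENNReal.summable.sum_add_tsum_nat_add' 
      (f := fun m => if n < m then _ else _) (k := n + 1),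
      Finset.sum_eq_zero, zero_add]
    · refine tsum_congr fun k => ?_
      rw [if_pos (by omega)]
      congr 1; ring
    · intro i hi
      rw [if_neg]
      have := Finset.mem_range.1 hi
      omega
  simp_rw [h1]
  rw [ENNReal.tsum_comm, meanReturnTime]
  refine tsum_congr fun m => ?_
  rw [tsum_eq_sum (s := Finset.range m) (fun n hn => if_neg (by simpa using hn)),
    Finset.sum_congr rfl (fun n hn => if_pos (Finset.mem_range.1 hn))]
  simp

/-- The excursion measure of a recurrent state is invariant. -/
lemma tsum_excursion_mul {a : I} (ha : hitProb Q a a = 1) (y : I) :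
    ∑' x, excursion Q a x * Q x y = excursion Q a y := by
  have h : ∑' x, excursion Q a x * Q x y = ∑' n, ∑' x, taboo Q a n x * Q x y := by
    simp_rw [excursion, ← ENNReal.tsum_mul_right]
    exact ENNReal.tsum_comm
  rw [h]
  by_cases hy : y = a
  · subst hy
    rw [excursion_self, ← ha, hitProb_eq_tsum_succ]
    refine tsum_congr fun n => ?_
    simpa [firstPassage_one] using tsum_taboo_mul_firstPassage (Q := Q) y n 0
  · conv_rhs => rw [excursion, tsum_eq_zero_add' ENNReal.summable]
    have h0 : taboo Q a 0 y = 0 := by simp [taboo, hy]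
    rw [h0, zero_add]
    refine tsum_congr fun n => ?_
    rw [taboo]
    exact tsum_congr fun x => by rw [avoid_of_ne hy]

/-- The excursion measure is the least subinvariant vector with value `1` at `a`. -/
lemma mul_excursion_le {ν : I → ℝ≥0∞} (hν : ∀ y, ∑' x, ν x * Q x y ≤ ν y) (a y : I) :
    ν a * excursion Q a y ≤ ν y := by
  have key : ∀ N y, ν a * ∑ n ∈ Finset.range N, taboo Q a n y ≤ ν y := by
    intro N
    induction N with
    | zero => simp
    | succ N ih =>
      intro y
      rw [Finset.sum_range_succ']
      by_cases hy : y = a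
      · subst hy
        simp [taboo_zero_self, taboo_succ_self]
      · have h0 : taboo Q a 0 y = 0 := by simp [taboo, hy]
        rw [h0, add_zero]
        simp_rw [taboo, avoid_of_ne hy]
        rw [← Summable.tsum_finsetSum (fun _ _ => ENNReal.summable), ← ENNReal.tsum_mul_left]
        refine le_trans (ENNReal.tsum_le_tsum fun x => ?_) (hν y)
        rw [← Finset.sum_mul, ← mul_assoc]
        gcongr
        exact ih x
  rw [excursion, ENNReal.tsum_eq_iSup_nat, ENNReal.mul_iSup]
  exact iSup_le fun N => key N y

/-- A finite subinvariant vector of an irreducible recurrent matrix is a multiple of the excursion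
measure: both vectors agree at `a`, and an agreement at `y` forces agreement at all states that
lead to `y` in one step. -/
lemma eq_mul_excursion (hQ : IsStochastic Q) (hirr : IsIrreducibleChain Q) {a : I}
    (ha : hitProb Q a a = 1) {ν : I → ℝ≥0∞} (hfin : ∀ y, ν y ≠ ∞)
    (hν : ∀ y, ∑' x, ν x * Q x y ≤ ν y) (y : I) : ν y = ν a * excursion Q a y := by
  induction hirr y a using Relation.ReflTransGen.head_induction_on with
  | refl => rw [excursion_self, mul_one]
  | @head b c hbc _ ih =>
    have hQfin : Q b c ≠ ∞ := hQ.ne_top b c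
    by_contra hne
    have hlt : ν a * excursion Q a b < ν b := lt_of_le_of_ne (mul_excursion_le hν a b) (Ne.symm hne)
    have h1 : ∑' x, ν a * excursion Q a x * Q x c = ν c := by
      simp_rw [mul_assoc]
      rw [ENNReal.tsum_mul_left, tsum_excursion_mul ha, ← ih]
    have h2 : ∑' x, ν a * excursion Q a x * Q x c < ∑' x, ν x * Q x c := by
      refine ENNReal.tsum_lt_tsum (i := b) ?_ ?_ ?_
      · rw [h1]; exact hfin c
      · exact fun k => by gcongr; exact mul_excursion_le hν a k
      · exact ENNReal.mul_lt_mul_left hbc.ne' hQfin hlt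
    exact absurd (hν c) (not_le.2 (h1 ▸ h2))

lemma excursion_pos (hirr : IsIrreducibleChain Q) {a : I}
    (ha : hitProb Q a a = 1) (y : I) : 0 < excursion Q a y := by
  induction hirr a y with
  | refl => rw [excursion_self]; exact one_pos
  | @tail b c _ hbc ih =>
    rw [← tsum_excursion_mul ha c]
    exact (ENNReal.mul_pos ih.ne' hbc.ne').trans_le (ENNReal.le_tsum b)

lemma meanReturnTime_ne_zero (hQ : IsStochastic Q) {a : I} (ha : hitProb Q a a = 1) :
    meanReturnTime Q a ≠ 0 := by
  rw [← tsum_excursion hQ ha]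
  refine ne_of_gt (lt_of_lt_of_le ?_ (ENNReal.le_tsum a))
  rw [excursion_self]; exact one_pos

/-- The normalized excursion measure. -/
noncomputable def statVec (Q : Matrix I I ℝ≥0∞) (a y : I) : ℝ≥0∞ :=
  (meanReturnTime Q a)⁻¹ * excursion Q a y

lemma isStationaryVector_statVec (hQ : IsStochastic Q) {a : I} (ha : hitProb Q a a = 1)
    (hm : meanReturnTime Q a < ∞) : IsStationaryVector (statVec Q a) Q := by
  refine ⟨?_, fun i => ?_⟩
  · simp_rw [statVec]
    rw [ENNReal.tsum_mul_left, tsum_excursion hQ ha,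
      ENNReal.inv_mul_cancel (meanReturnTime_ne_zero hQ ha) hm.ne]
  · simp_rw [statVec, mul_assoc]
    rw [ENNReal.tsum_mul_left, tsum_excursion_mul ha]

lemma statVec_pos (hirr : IsIrreducibleChain Q) {a : I}
    (ha : hitProb Q a a = 1) (hm : meanReturnTime Q a < ∞) (y : I) : 0 < statVec Q a y :=
  ENNReal.mul_pos (ENNReal.inv_ne_zero.2 hm.ne) (excursion_pos hirr ha y).ne'

/-- A subinvariant probability vector is the normalized excursion measure. -/
lemma eq_statVec (hQ : IsStochastic Q) (hirr : IsIrreducibleChain Q) {a : I}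
    (ha : hitProb Q a a = 1) {ν : I → ℝ≥0∞}
    (hsum : ∑' y, ν y = 1) (hν : ∀ y, ∑' x, ν x * Q x y ≤ ν y) :
    ν = statVec Q a := by
  have hfin : ∀ y, ν y ≠ ∞ := fun y => ne_top_of_le_ne_top ENNReal.one_ne_top
    (by rw [← hsum]; exact ENNReal.le_tsum y)
  have h := eq_mul_excursion hQ hirr ha hfin hν
  have h1 : ν a * meanReturnTime Q a = 1 := by
    rw [← tsum_excursion hQ ha, ← ENNReal.tsum_mul_left, ← hsum]
    exact tsum_congr fun y => (h y).symm
  funext y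
  rw [h y, statVec, ENNReal.eq_inv_of_mul_eq_one_left h1]

/-- If the mean return time is infinite, then there is no nonzero subinvariant vector of finite
mass. -/
lemma eq_zero_of_subinvariant (hQ : IsStochastic Q) (hirr : IsIrreducibleChain Q) {a : I}
    (ha : hitProb Q a a = 1) (hm : meanReturnTime Q a = ∞) {ν : I → ℝ≥0∞}
    (hsum : ∑' y, ν y ≤ 1) (hν : ∀ y, ∑' x, ν x * Q x y ≤ ν y) (y : I) : ν y = 0 := by
  have hfin : ∀ y, ν y ≠ ∞ := fun y => ne_top_of_le_ne_top ENNReal.one_ne_top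
    ((ENNReal.le_tsum y).trans hsum)
  have h := eq_mul_excursion hQ hirr ha hfin hν
  have h1 : ν a * ∞ ≤ 1 := by
    rw [← hm, ← tsum_excursion hQ ha, ← ENNReal.tsum_mul_left]
    refine le_trans (le_of_eq ?_) hsum
    exact tsum_congr fun y => (h y).symm
  have h0 : ν a = 0 := by
    by_contra h0
    rw [ENNReal.mul_top h0] at h1
    exact absurd h1 (by simp)
  rw [h y, h0, zero_mul]

end MatrixTheory

/-! ### Markov chains on a countable state space -/

section Chain

variable {I Ω : Type*}

/-- `X 0, X 1, …` is a Markov chain with transition matrix `Q` and arbitrary initial law. -/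
structure IsMarkovChain [MeasurableSpace I] [MeasurableSpace Ω] (Q : Matrix I I ℝ≥0∞) (ℙ : Measure Ω)
    (X : ℕ → Ω → I) : Prop where
  isProbabilityMeasure : IsProbabilityMeasure ℙ
  measurable : ∀ n, Measurable (X n)
  transition : ∀ (n : ℕ) (x : ℕ → I),
    ℙ {ω | ∀ k ≤ n + 1, X k ω = x k} = ℙ {ω | ∀ k ≤ n, X k ω = x k} * Q (x n) (x (n + 1))

/-- The event `A` is decided by `X 0, …, X n`. -/
def IsHist (X : ℕ → Ω → I) (n : ℕ) (A : Set Ω) : Prop :=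
  ∀ ω ω', (∀ k ≤ n, X k ω = X k ω') → ω ∈ A → ω' ∈ A

lemma IsHist.mono {X : ℕ → Ω → I} {m n : ℕ} (hmn : m ≤ n) {A : Set Ω} (hA : IsHist X m A) :
    IsHist X n A := fun ω ω' h => hA ω ω' fun k hk => h k (hk.trans hmn)

lemma IsHist.inter {X : ℕ → Ω → I} {n : ℕ} {A B : Set Ω} (hA : IsHist X n A)
    (hB : IsHist X n B) : IsHist X n (A ∩ B) :=
  fun ω ω' h hω => ⟨hA ω ω' h hω.1, hB ω ω' h hω.2⟩

lemma IsHist.compl {X : ℕ → Ω → I} {n : ℕ} {A : Set Ω} (hA : IsHist X n A) : IsHist X n Aᶜ :=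
  fun ω ω' h hω hω' => hω (hA ω' ω (fun k hk => (h k hk).symm) hω')

lemma isHist_univ (X : ℕ → Ω → I) (n : ℕ) : IsHist X n Set.univ := fun _ _ _ _ => trivial

lemma isHist_mem (X : ℕ → Ω → I) {k n : ℕ} (h : k ≤ n) (S : Set I) :
    IsHist X n {ω | X k ω ∈ S} := fun ω ω' hω (hS : X k ω ∈ S) => by
  have := hω k h
  exact show X k ω' ∈ S from this ▸ hS

variable [MeasurableSpace Ω] [MeasurableSpace I] [MeasurableSingletonClass I]

lemma IsMarkovChain.measurableSet_eq {Q : Matrix I I ℝ≥0∞} {ℙ : Measure Ω} {X : ℕ → Ω → I}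
    (hX : IsMarkovChain Q ℙ X) (n : ℕ) (a : I) :
    MeasurableSet {ω | X n ω = a} := hX.measurable n (measurableSet_singleton a)

/-- A measurable map into a countable type partitions every event. -/
lemma measure_eq_tsum_inter {J : Type*} [Countable J] [MeasurableSpace J]
    [MeasurableSingletonClass J] {h : Ω → J} (hh : Measurable h) (ℙ : Measure Ω) {B : Set Ω}
    (hB : MeasurableSet B) : ℙ B = ∑' v, ℙ (B ∩ {ω | h ω = v}) := by
  rw [← measure_iUnion]
  · congr 1
    ext ω; simp
  · intro v w hvw
    refine Set.disjoint_left.2 fun ω h1 h2 => hvw ?_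
    exact h1.2.symm.trans h2.2
  · exact fun v => hB.inter (hh (measurableSet_singleton v))

variable [Countable I]

lemma IsHist.measurableSet {X : ℕ → Ω → I} (hX : ∀ n, Measurable (X n)) {n : ℕ} {A : Set Ω}
    (hA : IsHist X n A) : MeasurableSet A := by
  have hh : Measurable (fun ω => fun k : Fin (n + 1) => X k ω) :=
    measurable_pi_lambda _ fun k => hX k
  have : A = (fun ω => fun k : Fin (n + 1) => X k ω) ⁻¹'
      ((fun ω => fun k : Fin (n + 1) => X k ω) '' A) := by
    refine Set.Subset.antisymm (Set.subset_preimage_image _ _) ?_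
    rintro ω ⟨ω', hω', h⟩
    exact hA ω' ω (fun k hk => congrFun h ⟨k, by omega⟩) hω'
  rw [this]
  exact hh (Set.to_countable _).measurableSet

namespace IsMarkovChain

variable {Q : Matrix I I ℝ≥0∞} {ℙ : Measure Ω} {X : ℕ → Ω → I}

/-- The Markov property: given the state `a` at time `n`, the next state is independent of the
history. -/
lemma measure_inter (hX : IsMarkovChain Q ℙ X) {n : ℕ} {A : Set Ω} (hA : IsHist X n A) (a b : I) :
    ℙ (A ∩ {ω | X n ω = a} ∩ {ω | X (n + 1) ω = b}) = ℙ (A ∩ {ω | X n ω = a}) * Q a b := by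
  have hh : Measurable (fun ω => fun k : Fin (n + 1) => X k ω) :=
    measurable_pi_lambda _ fun k => hX.measurable k
  have hm : MeasurableSet (A ∩ {ω | X n ω = a}) :=
    (hA.measurableSet hX.measurable).inter (hX.measurableSet_eq n a)
  rw [measure_eq_tsum_inter hh ℙ (hm.inter (hX.measurableSet_eq (n + 1) b)),
    measure_eq_tsum_inter hh ℙ hm, ← ENNReal.tsum_mul_right]
  refine tsum_congr fun v => ?_
  rcases (A ∩ {ω | X n ω = a} ∩ {ω | (fun k : Fin (n + 1) => X k ω) = v}).eq_empty_or_nonempty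
    with he | ⟨ω₀, ⟨h0A, h0a⟩, h0v⟩
  · rw [he, Set.inter_right_comm, he]; simp
  · have key : ∀ ω, (fun k : Fin (n + 1) => X k ω) = v ↔ ∀ k ≤ n, X k ω = X k ω₀ := fun ω => by
      rw [← show _ = v from h0v]
      exact ⟨fun h k hk => congrFun h ⟨k, by omega⟩, fun h => funext fun k => h k (by omega)⟩
    have h1 := hX.transition n (fun k => if k ≤ n then X k ω₀ else b)
    have h2 : {ω | ∀ k ≤ n, X k ω = if k ≤ n then X k ω₀ else b}
        = A ∩ {ω | X n ω = a} ∩ {ω | (fun k : Fin (n + 1) => X k ω) = v} := by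
      ext ω
      constructor
      · intro h
        have h' : ∀ k ≤ n, X k ω = X k ω₀ := fun k hk => by simpa [hk] using h k hk
        exact ⟨⟨hA ω₀ ω (fun k hk => (h' k hk).symm) h0A, (h' n le_rfl).trans h0a⟩, (key ω).2 h'⟩
      · rintro ⟨_, h⟩ k hk
        simpa [hk] using (key ω).1 h k hk
    have h3 : {ω | ∀ k ≤ n + 1, X k ω = if k ≤ n then X k ω₀ else b}
        = A ∩ {ω | X n ω = a} ∩ {ω | X (n + 1) ω = b}
          ∩ {ω | (fun k : Fin (n + 1) => X k ω) = v} := by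
      rw [Set.inter_right_comm, ← h2]
      ext ω
      constructor
      · intro h
        exact ⟨fun k hk => h k (by omega), by simpa using h (n + 1) le_rfl⟩
      · rintro ⟨h, h'⟩ k hk
        rcases Nat.le_succ_iff.1 hk with hk | rfl
        · exact h k hk
        · simpa using h'
    rw [h2, h3] at h1
    rw [h1]
    simp [show X n ω₀ = a from h0a]

lemma measure_eq_succ (hX : IsMarkovChain Q ℙ X) {n : ℕ} {A : Set Ω} (hA : IsHist X n A) (b : I) :
    ℙ (A ∩ {ω | X (n + 1) ω = b}) = ∑' a, ℙ (A ∩ {ω | X n ω = a}) * Q a b := by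
  rw [measure_eq_tsum_inter (hX.measurable n) ℙ
    ((hA.measurableSet hX.measurable).inter (hX.measurableSet_eq (n + 1) b))]
  refine tsum_congr fun a => ?_
  rw [Set.inter_right_comm, hX.measure_inter hA]

/-- The probability that the first visit to `j` after time `s` takes place at time `s + k + 1`. -/
lemma measure_inter_firstPassage (hX : IsMarkovChain Q ℙ X) (j : I) (k : ℕ) {s : ℕ} {A : Set Ω}
    (hA : IsHist X s A) :
    ℙ (A ∩ {ω | X (s + k + 1) ω = j ∧ ∀ i < k, X (s + i + 1) ω ≠ j})
      = ∑' x, ℙ (A ∩ {ω | X s ω = x}) * firstPassage Q j (k + 1) x := by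
  induction k generalizing s A with
  | zero => simpa [firstPassage_one] using hX.measure_eq_succ hA j
  | succ k ih =>
    have hA' : IsHist X (s + 1) (A ∩ {ω | X (s + 1) ω ∈ ({j}ᶜ : Set I)}) :=
      (hA.mono (Nat.le_succ s)).inter (isHist_mem X le_rfl _)
    have hset : A ∩ {ω | X (s + (k + 1) + 1) ω = j ∧ ∀ i < k + 1, X (s + i + 1) ω ≠ j}
        = (A ∩ {ω | X (s + 1) ω ∈ ({j}ᶜ : Set I)}) ∩
          {ω | X (s + 1 + k + 1) ω = j ∧ ∀ i < k, X (s + 1 + i + 1) ω ≠ j} := by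
      ext ω
      constructor
      · rintro ⟨h1, h2, h3⟩
        refine ⟨⟨h1, h3 0 (by omega)⟩, by rw [← h2]; congr 1; ring, fun i hi => ?_⟩
        have := h3 (i + 1) (by omega)
        rwa [show s + (i + 1) + 1 = s + 1 + i + 1 by ring] at this
      · rintro ⟨⟨h1, h4⟩, h2, h3⟩
        refine ⟨h1, by rw [← h2]; congr 1; ring, fun i hi => ?_⟩
        rcases i with _ | i
        · exact h4
        · have := h3 i (by omega)
          rwa [show s + 1 + i + 1 = s + (i + 1) + 1 by ring] at this
    rw [hset, ih hA']
    have h1 : ∀ y, ℙ (A ∩ {ω | X (s + 1) ω ∈ ({j}ᶜ : Set I)} ∩ {ω | X (s + 1) ω = y})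
        = ∑' x, ℙ (A ∩ {ω | X s ω = x}) * avoid Q j x y := fun y => by
      by_cases hy : y = j
      · subst hy
        simp only [avoid_self, mul_zero, tsum_zero]
        convert measure_empty (μ := ℙ)
        ext ω; simp +contextual
      · simp_rw [avoid_of_ne hy]
        rw [← hX.measure_eq_succ hA]
        congr 1
        ext ω
        constructor
        · exact fun h => ⟨h.1.1, h.2⟩
        · rintro ⟨h1, h2 : X (s + 1) ω = y⟩
          exact ⟨⟨h1, by simpa [h2] using hy⟩, h2⟩
    simp_rw [h1, ← ENNReal.tsum_mul_right]
    rw [ENNReal.tsum_comm]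
    refine tsum_congr fun x => ?_
    simp_rw [mul_assoc]
    rw [ENNReal.tsum_mul_left, ← firstPassage_succ_succ]

/-- A state which is hit almost surely from every state is visited infinitely often. -/
lemma ae_frequently_eq (hX : IsMarkovChain Q ℙ X) {j : I} (hj : ∀ x, hitProb Q j x = 1) :
    ∀ᵐ ω ∂ℙ, ∃ᶠ n in atTop, X n ω = j := by
  have hP := hX.isProbabilityMeasure
  have key : ∀ s, ∀ᵐ ω ∂ℙ, ∃ k, X (s + k + 1) ω = j := fun s => by
    have hmeas : ∀ k, MeasurableSet {ω | X (s + k + 1) ω = j ∧ ∀ i < k, X (s + i + 1) ω ≠ j} :=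
      fun k => by
        refine IsHist.measurableSet hX.measurable (n := s + k + 1) ?_
        rintro ω ω' h ⟨h1, h2⟩
        refine ⟨(h _ le_rfl).symm.trans h1, fun i hi => ?_⟩
        rw [← h (s + i + 1) (by omega)]
        exact h2 i hi
    have h1 : ℙ (⋃ k, {ω | X (s + k + 1) ω = j ∧ ∀ i < k, X (s + i + 1) ω ≠ j}) = 1 := by
      rw [measure_iUnion ?_ hmeas]
      · have h := fun k => hX.measure_inter_firstPassage j k (isHist_univ X s)
        simp only [Set.univ_inter] at h
        simp_rw [h]
        rw [ENNReal.tsum_comm]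
        simp_rw [ENNReal.tsum_mul_left, ← hitProb_eq_tsum_succ, hj, mul_one]
        have := measure_eq_tsum_inter (hX.measurable s) ℙ MeasurableSet.univ
        simp only [Set.univ_inter, measure_univ] at this
        exact this.symm
      · intro k l hkl
        refine Set.disjoint_left.2 fun ω h1 h2 => ?_
        rcases lt_or_gt_of_ne hkl with h | h
        · exact h2.2 k h h1.1
        · exact h1.2 l h h2.1
    have h2 := (prob_compl_eq_zero_iff (MeasurableSet.iUnion hmeas)).2 h1
    filter_upwards [measure_eq_zero_iff_ae_notMem.1 h2] with ω hω
    simp only [Set.mem_compl_iff, not_not, Set.mem_iUnion] at hω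
    obtain ⟨k, hk, _⟩ := hω
    exact ⟨k, hk⟩
  filter_upwards [ae_all_iff.2 key] with ω hω
  refine frequently_atTop.2 fun s => ?_
  obtain ⟨k, hk⟩ := hω s
  exact ⟨s + k + 1, by omega, hk⟩

lemma sum_measure_eq (hX : IsMarkovChain Q ℙ X) (j : I) (N s : ℕ) :
    ∑ n ∈ Finset.range N, ℙ {ω | X (s + n) ω = j} = ∑' x, ℙ {ω | X s ω = x} * greenSum Q j N x := by
  induction N generalizing s with
  | zero => simp [greenSum]
  | succ N ih =>
    have h1 : ∀ y, ℙ {ω | X (s + 1) ω = y} = ∑' x, ℙ {ω | X s ω = x} * Q x y := fun y => by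
      simpa using hX.measure_eq_succ (isHist_univ X s) y
    rw [Finset.sum_range_succ']
    have h2 : ∀ n, s + (n + 1) = s + 1 + n := fun n => by ring
    rw [Finset.sum_congr rfl fun n _ => by rw [h2 n], ih (s + 1)]
    simp_rw [greenSum, mul_add, ENNReal.tsum_add]
    simp_rw [h1]
    simp_rw [← ENNReal.tsum_mul_right]
    rw [ENNReal.tsum_comm, add_comm]
    congr 1
    · rw [tsum_eq_single j (fun x hx => by simp [hx])]
      simp
    · refine tsum_congr fun x => ?_
      simp_rw [mul_assoc]
      rw [ENNReal.tsum_mul_left]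

/-- A transient state is visited only finitely often. -/
lemma ae_eventually_ne (hX : IsMarkovChain Q ℙ X) (hQ : IsStochastic Q) {j : I}
    (hj : hitProb Q j j < 1) : ∀ᵐ ω ∂ℙ, ∀ᶠ n in atTop, X n ω ≠ j := by
  have hP := hX.isProbabilityMeasure
  obtain ⟨C, hC, hle⟩ := greenSum_bounded hQ hj
  refine ae_eventually_notMem (s := fun n => {ω | X n ω = j}) (ne_top_of_le_ne_top hC ?_)
  refine ENNReal.tsum_le_of_sum_range_le fun N => ?_
  have h := hX.sum_measure_eq j N 0
  simp_rw [zero_add] at h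
  rw [h]
  calc _ ≤ ∑' x, ℙ {ω | X 0 ω = x} * C := by gcongr; exact hle N _
    _ = C := by
      have := measure_eq_tsum_inter (hX.measurable 0) ℙ MeasurableSet.univ
      simp only [Set.univ_inter, measure_univ] at this
      rw [ENNReal.tsum_mul_right, ← this, one_mul]

end IsMarkovChain

end Chain

/-! ### A strong law for bounded orthogonal random variables -/

section Orthogonal

variable {Ω : Type*} [MeasurableSpace Ω] {ℙ : Measure Ω} [IsProbabilityMeasure ℙ]

lemma integrable_of_abs_le {f : Ω → ℝ} (hf : Measurable f) (C : ℝ) (h : ∀ ω, |f ω| ≤ C) :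
    Integrable f ℙ :=
  Integrable.of_bound hf.aestronglyMeasurable C (ae_of_all _ h)

lemma abs_sum_range_le {D : ℕ → ℝ} (hD : ∀ n, |D n| ≤ 1) (N : ℕ) :
    |∑ n ∈ Finset.range N, D n| ≤ N := by
  refine (Finset.abs_sum_le_sum_abs _ _).trans ?_
  calc _ ≤ ∑ n ∈ Finset.range N, (1 : ℝ) := Finset.sum_le_sum fun n _ => hD n
    _ = N := by simp

/-- A bounded sequence whose averages tend to zero along the squares has averages tending to
zero. -/
lemma tendsto_average_of_sq {D : ℕ → ℝ} (hD : ∀ n, |D n| ≤ 1)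
    (h : Tendsto (fun k : ℕ => (∑ n ∈ Finset.range (k ^ 2), D n) / (k : ℝ) ^ 2) atTop (𝓝 0)) :
    Tendsto (fun N : ℕ => (∑ n ∈ Finset.range N, D n) / (N : ℝ)) atTop (𝓝 0) := by
  have hsqrt : Tendsto Nat.sqrt atTop atTop :=
    tendsto_atTop.2 fun b => (eventually_ge_atTop (b * b)).mono fun N hN => Nat.le_sqrt.2 hN
  have h1 : Tendsto (fun N : ℕ => |(∑ n ∈ Finset.range (N.sqrt ^ 2), D n) / ((N.sqrt : ℕ) : ℝ) ^ 2|
      + 2 * ((N.sqrt : ℕ) : ℝ)⁻¹) atTop (𝓝 0) := by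
    have h2 := (h.comp hsqrt).abs
    have h3 := ((tendsto_inv_atTop_nhds_zero_nat (𝕜 := ℝ)).comp hsqrt).const_mul 2
    simpa using h2.add h3
  refine squeeze_zero_norm' ?_ h1
  filter_upwards [eventually_ge_atTop 1] with N hN
  set k := N.sqrt with hk
  have hk1 : 1 ≤ k := Nat.le_sqrt.2 (by omega)
  have hkN : k ^ 2 ≤ N := by rw [sq]; exact Nat.sqrt_le N
  have hNk : N ≤ k ^ 2 + 2 * k := by
    have := Nat.sqrt_le_add N
    rw [← hk] at this
    nlinarith
  have hsplit : ∑ n ∈ Finset.range N, D n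
      = ∑ n ∈ Finset.range (k ^ 2), D n + ∑ n ∈ Finset.range (N - k ^ 2), D (k ^ 2 + n) := by
    rw [← Finset.sum_range_add, Nat.add_sub_cancel' hkN]
  have hrest := abs_sum_range_le (fun n => hD (k ^ 2 + n)) (N - k ^ 2)
  have hrest' : ((N - k ^ 2 : ℕ) : ℝ) ≤ 2 * k := by
    have : N - k ^ 2 ≤ 2 * k := by omega
    exact_mod_cast this
  have hkpos : (0 : ℝ) < k := by exact_mod_cast hk1
  have hkN' : (k : ℝ) ^ 2 ≤ N := by exact_mod_cast hkN
  rw [Real.norm_eq_abs, abs_div, abs_div, abs_of_nonneg (by positivity : (0 : ℝ) ≤ (k : ℝ) ^ 2),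
    Nat.abs_cast]
  calc _ ≤ (|∑ n ∈ Finset.range (k ^ 2), D n| + 2 * k) / (k : ℝ) ^ 2 := by
        gcongr
        rw [hsplit]
        exact (abs_add_le _ _).trans (by linarith)
    _ = _ := by field_simp

/-- The strong law of large numbers for bounded, pairwise orthogonal random variables: the second
moment of the average over the first `k ^ 2` of them is at most `1 / k ^ 2`, which is summable. -/
lemma ae_tendsto_average_of_orthogonal {D : ℕ → Ω → ℝ} (hm : ∀ n, Measurable (D n))
    (hD : ∀ n ω, |D n ω| ≤ 1) (horth : ∀ m n, m < n → ∫ ω, D m ω * D n ω ∂ℙ = 0) :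
    ∀ᵐ ω ∂ℙ, Tendsto (fun N : ℕ => (∑ n ∈ Finset.range N, D n ω) / (N : ℝ)) atTop (𝓝 0) := by
  set S : ℕ → Ω → ℝ := fun N ω => ∑ n ∈ Finset.range N, D n ω with hS
  have hSm : ∀ N, Measurable (S N) := fun N => Finset.measurable_fun_sum _ fun n _ => hm n
  have hSb : ∀ N ω, |S N ω| ≤ N := fun N ω => abs_sum_range_le (fun n => hD n ω) N
  have hint : ∀ {f g : Ω → ℝ} (_ : Measurable f) (_ : Measurable g) (C : ℝ)
      (_ : ∀ ω, |f ω| ≤ C) (_ : ∀ ω, |g ω| ≤ 1), Integrable (fun ω => f ω * g ω) ℙ :=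
    fun hf hg C hfC hgC => integrable_of_abs_le (hf.mul hg) C fun ω => by
      rw [abs_mul]
      exact (mul_le_of_le_one_right (abs_nonneg _) (hgC ω)).trans (hfC ω)
  have hSS : ∀ N, Integrable (fun ω => S N ω ^ 2) ℙ := fun N =>
    integrable_of_abs_le ((hSm N).pow_const 2) ((N : ℝ) ^ 2) fun ω => by
      rw [abs_pow]; exact pow_le_pow_left₀ (abs_nonneg _) (hSb N ω) 2
  have hvar : ∀ N, ∫ ω, S N ω ^ 2 ∂ℙ ≤ N := by
    intro N
    induction N with
    | zero => simp [hS]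
    | succ N ih =>
      have h0 : ∫ ω, S N ω * D N ω ∂ℙ = 0 := by
        simp_rw [hS, Finset.sum_mul]
        rw [integral_finsetSum _ fun n _ => hint (hm n) (hm N) 1 (hD n) (hD N)]
        exact Finset.sum_eq_zero fun n hn => horth n N (Finset.mem_range.1 hn)
      have h1 : ∫ ω, D N ω * D N ω ∂ℙ ≤ 1 := by
        calc _ ≤ ∫ _, (1 : ℝ) ∂ℙ := by
              refine integral_mono (hint (hm N) (hm N) 1 (hD N) (hD N)) (integrable_const 1) ?_
              intro ω
              have := hD N ω
              change D N ω * D N ω ≤ 1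
              rw [← sq]
              exact (sq_le_one_iff_abs_le_one _).2 this
          _ = 1 := by simp
      have h2 : ∀ ω, S (N + 1) ω ^ 2 = S N ω ^ 2 + (2 * (S N ω * D N ω) + D N ω * D N ω) := by
        intro ω
        simp only [hS, Finset.sum_range_succ]
        ring
      simp_rw [h2]
      have i1 := hint (hSm N) (hm N) N (hSb N) (hD N)
      have i2 := hint (hm N) (hm N) 1 (hD N) (hD N)
      have i3 : Integrable (fun ω => 2 * (S N ω * D N ω) + D N ω * D N ω) ℙ :=
        (i1.const_mul 2).add i2
      rw [integral_add (hSS N) i3, integral_add (i1.const_mul 2) i2,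
        integral_const_mul, h0]
      push_cast
      linarith
  have hsum : ∑' k : ℕ, ∫⁻ ω, ENNReal.ofReal ((S (k ^ 2) ω / (k : ℝ) ^ 2) ^ 2) ∂ℙ ≠ ∞ := by
    have hbound : ∀ k : ℕ, ∫⁻ ω, ENNReal.ofReal ((S (k ^ 2) ω / (k : ℝ) ^ 2) ^ 2) ∂ℙ
        ≤ ENNReal.ofReal (1 / (k : ℝ) ^ 2) := by
      intro k
      have hI : Integrable (fun ω => (S (k ^ 2) ω / (k : ℝ) ^ 2) ^ 2) ℙ := by
        simp_rw [div_pow]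
        exact (hSS _).div_const _
      rw [← ofReal_integral_eq_lintegral_ofReal hI (ae_of_all _ fun ω => sq_nonneg _)]
      refine ENNReal.ofReal_le_ofReal ?_
      simp_rw [div_pow]
      rw [integral_div]
      rcases Nat.eq_zero_or_pos k with rfl | hk
      · simp
      · have hk' : (0 : ℝ) < k := by exact_mod_cast hk
        have := hvar (k ^ 2)
        rw [div_le_div_iff₀ (by positivity) (by positivity)]
        push_cast at this
        nlinarith [pow_pos hk' 2]
    refine ne_top_of_le_ne_top ?_ (ENNReal.tsum_le_tsum hbound)
    have hs : Summable fun k : ℕ => 1 / (k : ℝ) ^ 2 := Real.summable_one_div_nat_pow.2 (by norm_num)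
    exact hs.tsum_ofReal_ne_top
  have hmeas : ∀ k : ℕ, Measurable fun ω => ENNReal.ofReal ((S (k ^ 2) ω / (k : ℝ) ^ 2) ^ 2) :=
    fun k => (((hSm _).div_const _).pow_const 2).ennreal_ofReal
  rw [← lintegral_tsum fun k => (hmeas k).aemeasurable] at hsum
  filter_upwards [ae_lt_top (Measurable.tsum hmeas) hsum] with ω hω
  refine tendsto_average_of_sq (fun n => hD n ω) ?_
  have h1 := ENNReal.tendsto_atTop_zero_of_tsum_ne_top hω.ne
  have h2 : Tendsto (fun k : ℕ => (S (k ^ 2) ω / (k : ℝ) ^ 2) ^ 2) atTop (𝓝 0) := by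
    have := (ENNReal.tendsto_toReal ENNReal.zero_ne_top).comp h1
    simpa [Function.comp_def, ENNReal.toReal_ofReal, sq_nonneg] using this
  have h3 := h2.sqrt
  rw [Real.sqrt_zero] at h3
  simp_rw [Real.sqrt_sq_eq_abs] at h3
  exact (tendsto_zero_iff_abs_tendsto_zero _).2 h3

end Orthogonal

/-! ### Frequencies and recurrence of transitions -/

section Transitions

variable {I Ω : Type*} [MeasurableSpace Ω] [Countable I] [MeasurableSpace I]
  [MeasurableSingletonClass I] {Q : Matrix I I ℝ≥0∞} {ℙ : Measure Ω} {X : ℕ → Ω → I}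

lemma abs_indicator_one_le {α : Type*} (A : Set α) (x : α) : |A.indicator (1 : α → ℝ) x| ≤ 1 := by
  by_cases h : x ∈ A <;> simp [h]

/-- Let `E n` be events decided by the chain up to time `n` and contained in `X n = a`.
Asymptotically, the proportion of times at which `E n` occurs and is followed by a step from `a` to
`b` is `Q a b` times the proportion of times at which `E n` occurs. The summands are orthogonal by
the Markov property. -/
lemma IsMarkovChain.ae_tendsto_average (hX : IsMarkovChain Q ℙ X) (hQ : IsStochastic Q)
    {a b : I} {E : ℕ → Set Ω} (hE : ∀ n, IsHist X n (E n)) (hEa : ∀ n, ∀ ω ∈ E n, X n ω = a) :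
    ∀ᵐ ω ∂ℙ, Tendsto (fun N : ℕ => (∑ n ∈ Finset.range N,
      ((E n ∩ {ω | X (n + 1) ω = b}).indicator (1 : Ω → ℝ) ω
        - (Q a b).toReal * (E n).indicator (1 : Ω → ℝ) ω)) / (N : ℝ)) atTop (𝓝 0) := by
  have hP := hX.isProbabilityMeasure
  have hq1 : Q a b ≤ 1 := hQ.le_one a b
  have hq : (Q a b).toReal ≤ 1 := ENNReal.toReal_le_of_le_ofReal zero_le_one (by simpa using hq1)
  have hq0 : 0 ≤ (Q a b).toReal := ENNReal.toReal_nonneg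
  set q := (Q a b).toReal with hqdef
  set B : ℕ → Set Ω := fun n => {ω | X n ω = b} with hB
  have hBm : ∀ n, MeasurableSet (B n) := fun n => hX.measurableSet_eq n b
  have hEm : ∀ n, MeasurableSet (E n) := fun n => (hE n).measurableSet hX.measurable
  set D : ℕ → Ω → ℝ := fun n ω => (E n ∩ B (n + 1)).indicator (1 : Ω → ℝ) ω
    - q * (E n).indicator (1 : Ω → ℝ) ω with hD
  have hDm : ∀ n, Measurable (D n) := fun n =>
    (measurable_one.indicator ((hEm n).inter (hBm _))).sub
      ((measurable_one.indicator (hEm n)).const_mul q)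
  have hDb : ∀ n ω, |D n ω| ≤ 1 := fun n ω => by
    simp only [hD]
    by_cases h1 : ω ∈ E n <;> by_cases h2 : ω ∈ B (n + 1) <;> simp [h1, h2, abs_le] <;>
      constructor <;> linarith
  -- The increment at time `n` has mean zero on every event decided before.
  have hzero : ∀ {n : ℕ} {A : Set Ω}, IsHist X n A →
      ∫ ω, A.indicator (1 : Ω → ℝ) ω * D n ω ∂ℙ = 0 := by
    intro n A hA
    have hAm := hA.measurableSet hX.measurable
    have hprod : ∀ ω, A.indicator (1 : Ω → ℝ) ω * D n ω
        = (A ∩ (E n ∩ B (n + 1))).indicator (1 : Ω → ℝ) ω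
          - q * (A ∩ E n).indicator (1 : Ω → ℝ) ω := fun ω => by
      rw [Set.inter_indicator_one, Set.inter_indicator_one (s := A) (t := E n)]
      simp only [hD, Pi.mul_apply]
      ring
    simp_rw [hprod]
    have i1 := hAm.inter ((hEm n).inter (hBm (n + 1)))
    have i2 := hAm.inter (hEm n)
    have j1 : Integrable ((A ∩ (E n ∩ B (n + 1))).indicator (1 : Ω → ℝ)) ℙ :=
      (integrable_const 1).indicator i1
    have j2 : Integrable ((A ∩ E n).indicator (1 : Ω → ℝ)) ℙ := (integrable_const 1).indicator i2
    rw [integral_sub j1 (j2.const_mul q), integral_const_mul,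
      integral_indicator_one i1, integral_indicator_one i2]
    have h1 := hX.measure_inter (hA.inter (hE n)) a b
    have h2 : A ∩ E n ∩ {ω | X n ω = a} = A ∩ E n :=
      Set.inter_eq_left.2 fun ω hω => hEa n ω hω.2
    rw [h2] at h1
    rw [← Set.inter_assoc, measureReal_def, h1, ENNReal.toReal_mul, measureReal_def, mul_comm,
      sub_self]
  refine ae_tendsto_average_of_orthogonal hDm hDb fun m n hmn => ?_
  -- For `m < n`, `D m` is a combination of the indicators of two events decided by time `n`.
  have hBh : IsHist X n (B (m + 1)) := isHist_mem X hmn {b}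
  have hEh : IsHist X n (E m) := (hE m).mono hmn.le
  have hsplit : ∀ ω, D m ω * D n ω
      = (E m ∩ B (m + 1)).indicator (1 : Ω → ℝ) ω * D n ω
        - q * ((E m).indicator (1 : Ω → ℝ) ω * D n ω) := fun ω => by
    simp only [hD]; ring
  have hi : ∀ {A : Set Ω}, MeasurableSet A →
      Integrable (fun ω => A.indicator (1 : Ω → ℝ) ω * D n ω) ℙ := fun {A} hA =>
    integrable_of_abs_le ((measurable_one.indicator hA).mul (hDm n)) 1 fun ω => by
      rw [abs_mul]
      exact mul_le_one₀ (abs_indicator_one_le A ω) (abs_nonneg _) (hDb n ω)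
  refine (integral_congr_ae (ae_of_all ℙ hsplit)).trans ?_
  rw [integral_sub (hi ((hEm m).inter (hBm _))) ((hi (hEm m)).const_mul q), integral_const_mul,
    hzero (hEh.inter hBh), hzero hEh]
  simp

/-- The filtration of events decided by the chain up to time `n`. -/
def histFiltration (X : ℕ → Ω → I) (hX : ∀ n, Measurable (X n)) :
    Filtration ℕ (inferInstance : MeasurableSpace Ω) where
  seq n :=
    { MeasurableSet' := IsHist X n
      measurableSet_empty := fun _ _ _ h => h
      measurableSet_compl := fun _ h => h.compl
      measurableSet_iUnion := fun f hf ω ω' h hω => by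
        obtain ⟨i, hi⟩ := Set.mem_iUnion.1 hω
        exact Set.mem_iUnion.2 ⟨i, hf i ω ω' h hi⟩ }
  mono' := fun _ _ hmn _ hA => IsHist.mono hmn hA
  le' := fun _ _ hA => IsHist.measurableSet hX hA

/-- If `E n` is decided by the chain up to time `n`, is contained in `X n = a` and occurs infinitely
often, then it is followed infinitely often by a step from `a` to `b`, provided that such a step has
positive probability. This is Lévy's conditional form of the Borel-Cantelli lemma. -/
lemma IsMarkovChain.ae_frequently_inter (hX : IsMarkovChain Q ℙ X) (hQ : IsStochastic Q)
    {a b : I} (hab : 0 < Q a b) {E : ℕ → Set Ω} (hE : ∀ n, IsHist X n (E n))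
    (hEa : ∀ n, ∀ ω ∈ E n, X n ω = a) (hfreq : ∀ᵐ ω ∂ℙ, ∃ᶠ n in atTop, ω ∈ E n) :
    ∀ᵐ ω ∂ℙ, ∃ᶠ n in atTop, ω ∈ E n ∧ X (n + 1) ω = b := by
  have hP := hX.isProbabilityMeasure
  have hq0 : 0 < (Q a b).toReal := ENNReal.toReal_pos hab.ne' (hQ.ne_top a b)
  set q := (Q a b).toReal with hqdef
  set s : ℕ → Set Ω := fun n => Nat.casesOn n ∅ fun n => E n ∩ {ω | X (n + 1) ω = b} with hs
  set ℱ := histFiltration X hX.measurable with hℱ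
  have hsm : ∀ n, MeasurableSet[ℱ n] (s n) := by
    intro n
    cases n with
    | zero => exact @MeasurableSet.empty _ (ℱ 0)
    | succ n => exact ((hE n).mono (Nat.le_succ n)).inter (isHist_mem X le_rfl {b})
  have hEm : ∀ n, MeasurableSet (E n) := fun n => (hE n).measurableSet hX.measurable
  have hcond : ∀ k, (fun ω => q * (E k).indicator (1 : Ω → ℝ) ω)
      =ᵐ[ℙ] ℙ[(s (k + 1)).indicator (1 : Ω → ℝ) | ℱ k] := by
    intro k
    have hsk : MeasurableSet (s (k + 1)) := (hEm k).inter (hX.measurableSet_eq _ b)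
    refine ae_eq_condExp_of_forall_setIntegral_eq (ℱ.le k)
      ((integrable_const 1).indicator hsk) ?_ ?_ ?_
    · intro A _ _
      exact (((integrable_const 1).indicator (hEm k)).const_mul q).integrableOn
    · intro A hA _
      have hA' : IsHist X k A := hA
      have hAm := hA'.measurableSet hX.measurable
      rw [integral_const_mul, setIntegral_indicator (hEm k), setIntegral_indicator hsk]
      simp only [Pi.one_apply, integral_const, smul_eq_mul, mul_one,
        measureReal_restrict_apply_univ]
      have h1 := hX.measure_inter (hA'.inter (hE k)) a b
      have h2 : A ∩ E k ∩ {ω | X k ω = a} = A ∩ E k :=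
        Set.inter_eq_left.2 fun ω hω => hEa k ω hω.2
      rw [h2] at h1
      rw [show A ∩ s (k + 1) = A ∩ E k ∩ {ω | X (k + 1) ω = b} from (Set.inter_assoc _ _ _).symm,
        measureReal_def, measureReal_def, h1, ENNReal.toReal_mul, mul_comm]
    · refine StronglyMeasurable.aestronglyMeasurable ?_
      exact (stronglyMeasurable_one.indicator (show MeasurableSet[ℱ k] (E k) from hE k)).const_mul q
  filter_upwards [ae_mem_limsup_atTop_iff ℙ hsm, ae_all_iff.2 hcond, hfreq] with ω h1 h2 h3
  have h4 : Tendsto (fun n => ∑ k ∈ Finset.range n,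
      (ℙ[(s (k + 1)).indicator (1 : Ω → ℝ) | ℱ k]) ω) atTop atTop := by
    simp_rw [← h2, ← Finset.mul_sum]
    refine Tendsto.const_mul_atTop hq0 ?_
    have h5 : ω ∈ limsup E atTop := by
      rw [mem_limsup_iff_frequently_mem]; exact h3
    rw [Set.limsup_eq_tendsto_sum_indicator_atTop (zero_lt_one (α := ℝ))] at h5
    exact h5
  have h5 := h1.2 h4
  rw [mem_limsup_iff_frequently_mem] at h5
  refine frequently_atTop.2 fun N => ?_
  obtain ⟨n, hn, hω⟩ := frequently_atTop.1 h5 (N + 1)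
  obtain ⟨m, rfl⟩ : ∃ m, n = m + 1 := ⟨n - 1, by omega⟩
  exact ⟨m, by omega, hω⟩

end Transitions

/-! ### The maximal ergodic inequality -/

section Maximal

variable {X : Type*}

/-- The maximum of `0` and the first `n` Birkhoff sums of `g` along `θ`. -/
noncomputable def maxSum (θ : X → X) (g : X → ℝ) : ℕ → X → ℝ
  | 0, _ => 0
  | n + 1, x => max 0 (g x + maxSum θ g n (θ x))

lemma maxSum_nonneg (θ : X → X) (g : X → ℝ) (n : ℕ) (x : X) : 0 ≤ maxSum θ g n x := by
  cases n with
  | zero => exact le_rfl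
  | succ n => exact le_max_left _ _

lemma maxSum_mono (θ : X → X) (g : X → ℝ) (n : ℕ) (x : X) :
    maxSum θ g n x ≤ maxSum θ g (n + 1) x := by
  induction n generalizing x with
  | zero => exact maxSum_nonneg θ g 1 x
  | succ n ih =>
    rw [maxSum, maxSum]
    exact max_le_max le_rfl (by gcongr; exact ih _)

lemma sum_le_maxSum (θ : X → X) (g : X → ℝ) (n : ℕ) (x : X) :
    ∑ k ∈ Finset.range n, g (θ^[k] x) ≤ maxSum θ g n x := by
  induction n generalizing x with
  | zero => simp [maxSum]
  | succ n ih =>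
    rw [Finset.sum_range_succ', maxSum]
    refine le_max_of_le_right ?_
    have := ih (θ x)
    simp only [Function.iterate_succ_apply, Function.iterate_zero, id]
    linarith

variable [MeasurableSpace X] {μ : Measure X} [IsProbabilityMeasure μ] {θ : X → X}

/-- The maximal ergodic inequality for the indicator function of a set, by Garsia's argument: where
`maxSum n` is positive, it is at most `g + maxSum n ∘ θ`. -/
lemma mul_measureReal_maximal_le (hθ : MeasurePreserving θ μ μ) {A : Set X} (hA : MeasurableSet A)
    {ε : ℝ} (hε : 0 < ε) :
    ε * μ.real {x | ∃ N : ℕ, ε * N < ∑ n ∈ Finset.range N, A.indicator (1 : X → ℝ) (θ^[n] x)}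
      ≤ μ.real A := by
  set g : X → ℝ := fun x => A.indicator (1 : X → ℝ) x - ε with hg
  have hgm : Measurable g := (measurable_one.indicator hA).sub_const ε
  have i1 : Integrable (A.indicator (1 : X → ℝ)) μ := (integrable_const 1).indicator hA
  have hMm : ∀ n, Measurable (maxSum θ g n) := by
    intro n
    induction n with
    | zero => exact measurable_const
    | succ n ih => exact measurable_const.max (hgm.add (ih.comp hθ.measurable))
  have hMi : ∀ n, Integrable (maxSum θ g n) μ := by
    intro n
    induction n with
    | zero => exact integrable_zero _ _ _
    | succ n ih =>
      exact (integrable_zero _ _ _).sup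
        ((i1.sub (integrable_const ε)).add (hθ.integrable_comp_of_integrable ih))
  have hPm : ∀ n, MeasurableSet {x | 0 < maxSum θ g n x} := fun n =>
    measurableSet_lt measurable_const (hMm n)
  have hn : ∀ n, ε * μ.real {x | 0 < maxSum θ g n x} ≤ μ.real A := by
    intro n
    have hpt : ∀ x, maxSum θ g n x - maxSum θ g n (θ x)
        ≤ A.indicator (1 : X → ℝ) x
          - ε * {x | 0 < maxSum θ g n x}.indicator (1 : X → ℝ) x := by
      intro x
      have h0 := maxSum_nonneg θ g n (θ x)
      by_cases hx : 0 < maxSum θ g n x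
      · have h1 : maxSum θ g n x ≤ g x + maxSum θ g n (θ x) := by
          cases n with
          | zero => exact absurd hx (lt_irrefl _)
          | succ n =>
            have h2 : maxSum θ g (n + 1) x = g x + maxSum θ g n (θ x) := by
              rw [maxSum] at hx ⊢
              rcases le_total (g x + maxSum θ g n (θ x)) 0 with h | h
              · rw [max_eq_left h] at hx
                exact absurd hx (lt_irrefl _)
              · exact max_eq_right h
            rw [h2]
            gcongr
            exact maxSum_mono θ g n (θ x)
        rw [Set.indicator_of_mem (show x ∈ {x | 0 < maxSum θ g n x} from hx)]
        simp only [hg] at h1 h0 ⊢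
        simp only [Pi.one_apply]
        linarith
      · have h1 := Set.indicator_nonneg (s := A) (f := (1 : X → ℝ)) (fun _ _ => zero_le_one) x
        rw [Set.indicator_of_notMem (show x ∉ {x | 0 < maxSum θ g n x} from hx)]
        linarith
    have i2 : Integrable (fun x => maxSum θ g n (θ x)) μ := hθ.integrable_comp_of_integrable (hMi n)
    have i3 : Integrable ({x | 0 < maxSum θ g n x}.indicator (1 : X → ℝ)) μ :=
      (integrable_const 1).indicator (hPm n)
    have h := integral_mono ((hMi n).sub i2) (i1.sub (i3.const_mul ε)) hpt
    have h' : ∫ x, maxSum θ g n (θ x) ∂μ = ∫ x, maxSum θ g n x ∂μ := by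
      have := integral_map (μ := μ) hθ.measurable.aemeasurable
        (f := maxSum θ g n) (by rw [hθ.map_eq]; exact (hMi n).aestronglyMeasurable)
      rw [hθ.map_eq] at this
      exact this.symm
    simp only [Pi.sub_apply] at h
    rw [integral_sub (hMi n) i2, h', sub_self, integral_sub i1 (i3.const_mul ε),
      integral_const_mul, integral_indicator_one hA, integral_indicator_one (hPm n)] at h
    linarith
  have hsub : {x | ∃ N : ℕ, ε * N < ∑ n ∈ Finset.range N, A.indicator (1 : X → ℝ) (θ^[n] x)}
      ⊆ ⋃ n, {x | 0 < maxSum θ g n x} := by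
    rintro x ⟨N, hN⟩
    refine Set.mem_iUnion.2 ⟨N, lt_of_lt_of_le ?_ (sum_le_maxSum θ g N x)⟩
    simp only [hg, Finset.sum_sub_distrib, Finset.sum_const, Finset.card_range, nsmul_eq_mul]
    linarith
  have hmono : Monotone fun n => {x | 0 < maxSum θ g n x} :=
    monotone_nat_of_le_succ fun n x hx => lt_of_lt_of_le hx (maxSum_mono θ g n x)
  have hlim : Tendsto (fun n => ε * μ.real {x | 0 < maxSum θ g n x}) atTop
      (𝓝 (ε * μ.real (⋃ n, {x | 0 < maxSum θ g n x}))) :=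
    ((ENNReal.tendsto_toReal (measure_ne_top _ _)).comp
      (tendsto_measure_iUnion_atTop hmono)).const_mul ε
  calc _ ≤ ε * μ.real (⋃ n, {x | 0 < maxSum θ g n x}) := by gcongr; exact measure_ne_top _ _
    _ ≤ _ := le_of_tendsto' hlim hn

end Maximal

/-! ### Path measures -/

section Paths

/-- Existence of Markov chains with a given initial law and a given transition kernel, in terms of
the probabilities of single paths. -/
lemma exists_pathMeasure {X : Type*} [MeasurableSpace X] [MeasurableSingletonClass X]
    (ν : Measure X) [IsProbabilityMeasure ν] (κ : ProbabilityTheory.Kernel X X) [ProbabilityTheory.IsMarkovKernel κ] :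
    ∃ ℙ : Measure (ℕ → X), IsProbabilityMeasure ℙ ∧ (∀ a, ℙ {y | y 0 = a} = ν {a}) ∧
      ∀ (n : ℕ) (x : ℕ → X), ℙ {y | ∀ k ≤ n + 1, y k = x k}
        = ℙ {y | ∀ k ≤ n, y k = x k} * κ (x n) {x (n + 1)} := by
  set η : (n : ℕ) → ProbabilityTheory.Kernel ((i : Finset.Iic n) → X) X := fun n =>
    κ.comap (fun v => v ⟨n, Finset.mem_Iic.2 le_rfl⟩) (measurable_pi_apply _) with hη
  set ℙ : Measure (ℕ → X) := ProbabilityTheory.Kernel.trajMeasure (X := fun _ => X) ν η with hℙ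
  refine ⟨ℙ, inferInstance, fun a => ?_, fun n x => ?_⟩
  · have h1 : ℙ.map (Preorder.frestrictLe 0)
        = ν.map (MeasurableEquiv.piUnique (fun _ : Finset.Iic 0 => X)).symm := by
      rw [hℙ, ProbabilityTheory.Kernel.trajMeasure, Measure.map_comp _ _ (by fun_prop), ProbabilityTheory.Kernel.traj_map_frestrictLe,
        ProbabilityTheory.Kernel.partialTraj_self, Measure.id_comp]
    have h2 : {y : ℕ → X | y 0 = a} = Preorder.frestrictLe (π := fun _ => X) 0 ⁻¹'
        {v | v ⟨0, Finset.mem_Iic.2 le_rfl⟩ = a} := rfl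
    have h3 : MeasurableSet {v : (i : Finset.Iic 0) → X | v ⟨0, Finset.mem_Iic.2 le_rfl⟩ = a} := by
      have hm : Measurable fun v : (i : Finset.Iic 0) → X => v ⟨0, Finset.mem_Iic.2 le_rfl⟩ :=
        measurable_pi_apply _
      exact hm (measurableSet_singleton a)
    rw [h2, ← Measure.map_apply (by fun_prop) h3, h1, Measure.map_apply (by fun_prop) h3]
    rfl
  · have h := ProbabilityTheory.Kernel.map_frestrictLe_trajMeasure_compProd_eq_map_trajMeasure (X := fun _ => X)
      (μ₀ := ν) (κ := η) (a := n)
    set v : (i : Finset.Iic n) → X := fun i => x i with hv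
    have h1 := congrArg (fun μ => μ ({v} ×ˢ {x (n + 1)})) h
    rw [Measure.compProd_apply_prod (measurableSet_singleton _) (measurableSet_singleton _),
      Measure.restrict_singleton, lintegral_smul_measure, lintegral_dirac,
      Measure.map_apply (by fun_prop) (measurableSet_singleton _),
      Measure.map_apply (by fun_prop)
        ((measurableSet_singleton _).prod (measurableSet_singleton _))] at h1
    have h2 : Preorder.frestrictLe (π := fun _ => X) n ⁻¹' {v} = {y | ∀ k ≤ n, y k = x k} := by
      ext y
      simp only [Set.mem_preimage, Set.mem_singleton_iff, Set.mem_ofPred_eq]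
      exact ⟨fun h k hk => congrFun h ⟨k, Finset.mem_Iic.2 hk⟩,
        fun h => funext fun k => h k (Finset.mem_Iic.1 k.2)⟩
    have h3 : (fun y : ℕ → X => (Preorder.frestrictLe (π := fun _ => X) n y, y (n + 1))) ⁻¹'
        ({v} ×ˢ {x (n + 1)}) = {y | ∀ k ≤ n + 1, y k = x k} := by
      rw [Set.mk_preimage_prod, h2]
      ext y
      constructor
      · rintro ⟨h, h'⟩ k hk
        rcases Nat.le_succ_iff.1 hk with hk | rfl
        · exact h k hk
        · exact h'
      · exact fun h => ⟨fun k hk => h k (by omega), h (n + 1) le_rfl⟩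
    rw [h2, h3] at h1
    rw [← h1]
    rfl

variable {I : Type*} [MeasurableSpace I]

lemma IsMarkovChain.measure_cylinder {Ω : Type*} [MeasurableSpace Ω] {Q : Matrix I I ℝ≥0∞}
    {ℙ : Measure Ω} {X : ℕ → Ω → I} (hX : IsMarkovChain Q ℙ X) (n : ℕ) (w : ℕ → I) :
    ℙ {ω | ∀ k ≤ n, X k ω = w k}
      = ℙ {ω | X 0 ω = w 0} * ∏ k ∈ Finset.range n, Q (w k) (w (k + 1)) := by
  induction n with
  | zero => simp
  | succ n ih => rw [hX.transition, ih, Finset.prod_range_succ, mul_assoc]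

variable [Countable I] [MeasurableSingletonClass I]

/-- A finite measure on the path space is determined by its values on cylinder sets. -/
lemma ext_of_cylinder {μ ν : Measure (ℕ → I)} [IsFiniteMeasure μ] [IsFiniteMeasure ν]
    (h : ∀ (n : ℕ) (w : ℕ → I), μ {x | ∀ k ≤ n, x k = w k} = ν {x | ∀ k ≤ n, x k = w k}) :
    μ = ν := by
  rcases isEmpty_or_nonempty I with hI | hI
  · have : IsEmpty (ℕ → I) := ⟨fun x => hI.elim (x 0)⟩
    rw [Measure.eq_zero_of_isEmpty μ, Measure.eq_zero_of_isEmpty ν]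
  obtain ⟨i₀⟩ := hI
  have hproj : IsProjectiveMeasureFamily (α := fun _ : ℕ => I) (fun J => ν.map J.restrict) := by
    intro J K hKJ
    rw [Measure.map_map (by fun_prop) (by fun_prop)]
    rfl
  have h1 : IsProjectiveLimit (α := fun _ : ℕ => I) ν (fun J => ν.map J.restrict) :=
    fun J => rfl
  have h2 : IsProjectiveLimit (α := fun _ : ℕ => I) μ (fun J => ν.map J.restrict) := by
    rw [isProjectiveLimit_nat_iff hproj]
    intro n
    refine Measure.ext_of_singleton fun v => ?_
    have h3 : Preorder.frestrictLe (π := fun _ => I) n ⁻¹' {v}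
        = {x | ∀ k ≤ n, x k = if hk : k ≤ n then v ⟨k, Finset.mem_Iic.2 hk⟩ else i₀} := by
      ext y
      simp only [Set.mem_preimage, Set.mem_singleton_iff, Set.mem_ofPred_eq]
      constructor
      · rintro rfl k hk
        simp [hk]
      · intro h
        funext k
        have := h k (Finset.mem_Iic.1 k.2)
        rw [dif_pos (Finset.mem_Iic.1 k.2)] at this
        exact this
    rw [Measure.map_apply (by fun_prop) (measurableSet_singleton _), h3, h, ← h3]
    exact (Measure.map_apply (by fun_prop) (measurableSet_singleton v)).symm
  exact h2.unique h1

/-- The measure on a countable type with the given weights. -/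
noncomputable def weightMeasure (f : I → ℝ≥0∞) : Measure I :=
  Measure.sum fun y => f y • Measure.dirac y

lemma weightMeasure_apply (f : I → ℝ≥0∞) (s : Set I) :
    weightMeasure f s = ∑' y, f y * s.indicator 1 y := by
  rw [weightMeasure, Measure.sum_apply _ (Set.to_countable s).measurableSet]
  simp [Measure.dirac_apply' _ (Set.to_countable s).measurableSet]

lemma weightMeasure_singleton (f : I → ℝ≥0∞) (a : I) : weightMeasure f {a} = f a := by
  rw [weightMeasure_apply, tsum_eq_single a (fun b hb => by simp [hb])]
  simp

lemma isProbabilityMeasure_weightMeasure {f : I → ℝ≥0∞} (hf : ∑' y, f y = 1) :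
    IsProbabilityMeasure (weightMeasure f) :=
  ⟨by rw [weightMeasure_apply]; simpa using hf⟩

/-- The coordinates form a Markov chain under a suitable measure on the path space. -/
lemma exists_isMarkovChain {Q : Matrix I I ℝ≥0∞} (hQ : IsStochastic Q) {π : I → ℝ≥0∞}
    (hπ : ∑' i, π i = 1) :
    ∃ ρ : Measure (ℕ → I), IsMarkovChain Q ρ (fun n x => x n) ∧ ∀ a, ρ {x | x 0 = a} = π a := by
  have := isProbabilityMeasure_weightMeasure hπ
  let κ : ProbabilityTheory.Kernel I I := ⟨fun x => weightMeasure (Q x), measurable_of_countable _⟩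
  have hκ : ProbabilityTheory.IsMarkovKernel κ := ⟨fun x => isProbabilityMeasure_weightMeasure (hQ x)⟩
  obtain ⟨ρ, h1, h2, h3⟩ := exists_pathMeasure (weightMeasure π) κ
  refine ⟨ρ, ⟨h1, fun n => measurable_pi_apply n, fun n x => ?_⟩, fun a => ?_⟩
  · rw [h3]
    congr 1
    exact weightMeasure_singleton (Q (x n)) _
  · rw [h2, weightMeasure_singleton]

/-- A chain which starts from a stationary vector is a stationary process. -/
lemma IsMarkovChain.measurePreserving_shift {Q : Matrix I I ℝ≥0∞} {ρ : Measure (ℕ → I)}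
    (hρ : IsMarkovChain Q ρ (fun n x => x n)) {π : I → ℝ≥0∞} (hπ : IsStationaryVector π Q)
    (h0 : ∀ a, ρ {x | x 0 = a} = π a) :
    MeasurePreserving (fun (x : ℕ → I) n => x (n + 1)) ρ ρ := by
  have hP := hρ.isProbabilityMeasure
  have hm : Measurable (fun (x : ℕ → I) n => x (n + 1)) :=
    measurable_pi_lambda _ fun n => measurable_pi_apply _
  refine ⟨hm, ?_⟩
  have : IsProbabilityMeasure (ρ.map fun (x : ℕ → I) n => x (n + 1)) :=
    Measure.isProbabilityMeasure_map hm.aemeasurable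
  refine ext_of_cylinder fun n w => ?_
  have hcyl : ∀ (n : ℕ) (w : ℕ → I), MeasurableSet {x : ℕ → I | ∀ k ≤ n, x k = w k} := fun n w =>
    IsHist.measurableSet (X := fun n (x : ℕ → I) => x n) (n := n) measurable_pi_apply
      fun x y hxy hx k hk => (hxy k hk).symm.trans (hx k hk)
  rw [Measure.map_apply hm (hcyl n w), measure_eq_tsum_inter (measurable_pi_apply 0) ρ
    (hm (hcyl n w)), hρ.measure_cylinder, h0, ← hπ.2, ← ENNReal.tsum_mul_right]
  refine tsum_congr fun i => ?_
  have h1 : (fun (x : ℕ → I) n => x (n + 1)) ⁻¹' {x | ∀ k ≤ n, x k = w k} ∩ {x | x 0 = i}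
      = {x | ∀ k ≤ n + 1, x k = Nat.casesOn (motive := fun _ => I) k i w} := by
    ext x
    constructor
    · rintro ⟨h, h'⟩ k hk
      cases k with
      | zero => exact h'
      | succ k => exact h k (by omega)
    · exact fun h => ⟨fun k hk => h (k + 1) (by omega), h 0 (by omega)⟩
  rw [h1, hρ.measure_cylinder (n + 1), Finset.prod_range_succ', h0]
  rw [mul_assoc, mul_comm (Q i (w 0))]
  rfl

/-- If there is a stationary vector `π` with `π a > 0`, then the chain started at `a` almost surely
spends at most a small proportion of any initial time interval outside a large finite set. The
maximal ergodic inequality gives this for the stationary chain, which has the law of the given chain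
when it is conditioned to start at `a`. -/
lemma IsMarkovChain.ae_exists_finset {Ω : Type*} [MeasurableSpace Ω] {Q : Matrix I I ℝ≥0∞}
    {ℙ : Measure Ω} {X : ℕ → Ω → I} (hX : IsMarkovChain Q ℙ X) (hQ : IsStochastic Q)
    {π : I → ℝ≥0∞} (hπ : IsStationaryVector π Q) {a : I} (ha : 0 < π a)
    (hXa : ℙ {ω | X 0 ω = a} = 1) {ε : ℝ} (hε : 0 < ε) :
    ∀ᵐ ω ∂ℙ, ∃ F : Finset I, ∀ N : ℕ,
      ∑ n ∈ Finset.range N, ((F : Set I)ᶜ).indicator (1 : I → ℝ) (X n ω) ≤ ε * N := by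
  obtain ⟨ρ, hρ, h0⟩ := exists_isMarkovChain hQ hπ.1
  have hPρ := hρ.isProbabilityMeasure
  have hP := hX.isProbabilityMeasure
  have hθ := hρ.measurePreserving_shift hπ h0
  set θ := fun (x : ℕ → I) n => x (n + 1) with hθdef
  have hiter : ∀ n (x : ℕ → I), θ^[n] x 0 = x n := by
    have : ∀ n (x : ℕ → I) m, θ^[n] x m = x (n + m) := by
      intro n
      induction n with
      | zero => simp
      | succ n ih =>
        intro x m
        rw [Function.iterate_succ_apply, ih, hθdef]
        simp only
        congr 1
        ring
    intro n x
    rw [this, add_zero]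
  -- Conditioned to start at `a`, the stationary chain has the law of `X`.
  have hmap : (ρ.restrict {x | x 0 = a}) = π a • ℙ.map (fun ω n => X n ω) := by
    have hXm : Measurable (fun ω n => X n ω) := measurable_pi_lambda _ hX.measurable
    have : IsProbabilityMeasure (ℙ.map (fun ω n => X n ω)) :=
      Measure.isProbabilityMeasure_map hXm.aemeasurable
    have : IsFiniteMeasure (π a • ℙ.map (fun ω n => X n ω)) := Measure.smul_finite _ (hπ.ne_top a)
    refine ext_of_cylinder fun n w => ?_
    have hcyl : MeasurableSet {x : ℕ → I | ∀ k ≤ n, x k = w k} :=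
      IsHist.measurableSet (X := fun n (x : ℕ → I) => x n) (n := n) measurable_pi_apply
        fun x y hxy hx k hk => (hxy k hk).symm.trans (hx k hk)
    rw [Measure.restrict_apply hcyl, Measure.smul_apply, Measure.map_apply hXm hcyl, smul_eq_mul]
    have h2 := hX.measure_cylinder n w
    have h1 := hρ.measure_cylinder n w
    rw [h0] at h1
    by_cases hw : w 0 = a
    · have h3 : {x : ℕ → I | ∀ k ≤ n, x k = w k} ∩ {x | x 0 = a} = {x | ∀ k ≤ n, x k = w k} :=
        Set.inter_eq_left.2 fun x hx => (hx 0 (Nat.zero_le n)).trans hw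
      rw [h3, h1]
      change _ = π a * ℙ {ω | ∀ k ≤ n, X k ω = w k}
      rw [h2, hw, hXa, one_mul]
    · have h3 : {x : ℕ → I | ∀ k ≤ n, x k = w k} ∩ {x | x 0 = a} = ∅ :=
        Set.eq_empty_of_forall_notMem fun x hx =>
          hw ((hx.1 0 (Nat.zero_le n)).symm.trans hx.2)
      have h4 : ℙ {ω | X 0 ω = w 0} = 0 := by
        have h5 := (prob_compl_eq_zero_iff (hX.measurableSet_eq 0 a)).2 hXa
        refine measure_mono_null (fun ω hω => ?_) h5
        exact fun h => hw (hω.symm.trans h)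
      rw [h3, measure_empty]
      change _ = π a * ℙ {ω | ∀ k ≤ n, X k ω = w k}
      rw [h2, h4, zero_mul, mul_zero]
  -- The bad event for `F` has probability at most `π(Fᶜ) / ε`, which tends to zero.
  have hae : ∀ᵐ x ∂ρ, ∃ F : Finset I, ∀ N : ℕ,
      ∑ n ∈ Finset.range N, ((F : Set I)ᶜ).indicator (1 : I → ℝ) (x n) ≤ ε * N := by
    rw [ae_iff]
    have hle : ∀ F : Finset I, ENNReal.ofReal ε * ρ {x | ¬ ∃ F : Finset I, ∀ N : ℕ,
        ∑ n ∈ Finset.range N, ((F : Set I)ᶜ).indicator (1 : I → ℝ) (x n) ≤ ε * N}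
        ≤ ∑' i : {i // i ∉ F}, π i := by
      intro F
      have hA : MeasurableSet {x : ℕ → I | x 0 ∈ ((F : Set I)ᶜ)} :=
        measurable_pi_apply 0 (Set.to_countable _).measurableSet
      have h1 := mul_measureReal_maximal_le hθ hA hε
      have h2 : ρ {x : ℕ → I | x 0 ∈ ((F : Set I)ᶜ)} = ∑' i : {i // i ∉ F}, π i := by
        rw [← tsum_congr fun i : {i // i ∉ F} => h0 i]
        exact (tsum_measure_preimage_singleton (μ := ρ) (f := fun x : ℕ → I => x 0)
          (Set.to_countable ((F : Set I)ᶜ))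
          (fun i _ => measurable_pi_apply 0 (measurableSet_singleton i))).symm
      rw [← h2]
      calc _ ≤ ENNReal.ofReal ε * ρ {x | ∃ N : ℕ, ε * N < ∑ n ∈ Finset.range N,
            {x : ℕ → I | x 0 ∈ ((F : Set I)ᶜ)}.indicator (1 : (ℕ → I) → ℝ) (θ^[n] x)} := by
            refine mul_le_mul_right (measure_mono fun x hx => ?_) _
            simp only [Set.mem_ofPred_eq, not_exists, not_forall, not_le] at hx ⊢
            obtain ⟨N, hN⟩ := hx F
            refine ⟨N, hN.trans_eq (Finset.sum_congr rfl fun n _ => ?_)⟩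
            rw [← hiter n x]
            rfl
        _ ≤ _ := by
            rw [← ENNReal.ofReal_toReal (measure_ne_top ρ {x | ∃ N : ℕ, _}),
              ← ENNReal.ofReal_mul hε.le, ← ENNReal.ofReal_toReal (measure_ne_top ρ {x | x 0 ∈ _})]
            exact ENNReal.ofReal_le_ofReal h1
    have hlim := ENNReal.tendsto_tsum_compl_atTop_zero (f := π) (by rw [hπ.1]; simp)
    have h3 := ge_of_tendsto' hlim hle
    have h4 := le_antisymm h3 zero_le
    exact (mul_eq_zero.1 h4).resolve_left (ENNReal.ofReal_pos.2 hε).ne'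
  have h1 := ae_restrict_of_ae (s := {x : ℕ → I | x 0 = a}) hae
  rw [hmap, Measure.ae_ennreal_smul_measure_iff ha.ne'] at h1
  exact ae_of_ae_map (measurable_pi_lambda _ hX.measurable).aemeasurable h1

end Paths

/-! ### Limiting frequencies along a typical path -/

section Frequencies

open Classical in
/-- The indicator of a proposition. -/
noncomputable def ind (p : Prop) : ℝ := if p then 1 else 0

lemma ind_of_true {p : Prop} (h : p) : ind p = 1 := if_pos h

lemma ind_of_false {p : Prop} (h : ¬p) : ind p = 0 := if_neg h

lemma ind_nonneg (p : Prop) : 0 ≤ ind p := by unfold ind; split_ifs <;> simp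

lemma ind_le_one (p : Prop) : ind p ≤ 1 := by unfold ind; split_ifs <;> simp

lemma indicator_one_eq_ind {α : Type*} (A : Set α) (x : α) :
    A.indicator (1 : α → ℝ) x = ind (x ∈ A) := by
  by_cases h : x ∈ A <;> simp [h, ind]

/-- The average of the first `N` terms of a sequence (`0` for `N = 0`). -/
noncomputable def avg (f : ℕ → ℝ) (N : ℕ) : ℝ := (∑ n ∈ Finset.range N, f n) / N

lemma avg_nonneg {f : ℕ → ℝ} (hf : ∀ n, 0 ≤ f n) (N : ℕ) : 0 ≤ avg f N :=
  div_nonneg (Finset.sum_nonneg fun n _ => hf n) (Nat.cast_nonneg N)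

lemma avg_mono {f g : ℕ → ℝ} (h : ∀ n, f n ≤ g n) (N : ℕ) : avg f N ≤ avg g N :=
  div_le_div_of_nonneg_right (Finset.sum_le_sum fun n _ => h n) (Nat.cast_nonneg N)

lemma nonneg_of_tendsto_avg_ind {p : ℕ → Prop} {u : Ultrafilter ℕ} {l : ℝ}
    (h : Tendsto (avg fun n => ind (p n)) u (𝓝 l)) : 0 ≤ l :=
  ge_of_tendsto' h fun N => avg_nonneg (fun _ => ind_nonneg _) N

lemma avg_one {N : ℕ} (hN : N ≠ 0) : avg (fun _ => 1) N = 1 := by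
  simp [avg, hN]

lemma avg_le_one {f : ℕ → ℝ} (hf : ∀ n, f n ≤ 1) (N : ℕ) : avg f N ≤ 1 := by
  rcases eq_or_ne N 0 with rfl | hN
  · simp [avg]
  · exact (avg_mono hf N).trans_eq (avg_one hN)

lemma avg_finsetSum {ι : Type*} (F : Finset ι) (f : ι → ℕ → ℝ) (N : ℕ) :
    avg (fun n => ∑ i ∈ F, f i n) N = ∑ i ∈ F, avg (f i) N := by
  simp only [avg]
  rw [Finset.sum_comm, Finset.sum_div]

lemma avg_sub_mul (f g : ℕ → ℝ) (c : ℝ) (N : ℕ) :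
    avg (fun n => f n - c * g n) N = avg f N - c * avg g N := by
  simp only [avg, Finset.sum_sub_distrib, ← Finset.mul_sum]
  ring

lemma avg_add (f g : ℕ → ℝ) (N : ℕ) : avg (fun n => f n + g n) N = avg f N + avg g N := by
  simp only [avg, Finset.sum_add_distrib, add_div]

lemma avg_succ (f : ℕ → ℝ) (N : ℕ) :
    avg (fun n => f (n + 1)) N = avg f N + (f N - f 0) / N := by
  have h1 := Finset.sum_range_succ f N
  rw [Finset.sum_range_succ'] at h1
  simp only [avg]
  rw [← add_div]
  congr 1
  linarith

/-- Shifting a bounded sequence does not change the limiting behaviour of its averages. -/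
lemma tendsto_avg_succ_sub {f : ℕ → ℝ} (hf : ∀ n, |f n| ≤ 1) :
    Tendsto (fun N => avg (fun n => f (n + 1)) N - avg f N) atTop (𝓝 0) := by
  have h1 : Tendsto (fun N : ℕ => 2 * ((N : ℝ))⁻¹) atTop (𝓝 0) := by
    simpa using (tendsto_inv_atTop_nhds_zero_nat (𝕜 := ℝ)).const_mul 2
  refine squeeze_zero_norm (fun N => ?_) h1
  rw [avg_succ, add_sub_cancel_left, Real.norm_eq_abs, abs_div, Nat.abs_cast, div_eq_mul_inv]
  gcongr
  exact (abs_sub _ _).trans (by linarith [hf N, hf 0])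

variable {I : Type*} {Q : Matrix I I ℝ≥0∞} {x : ℕ → I}

lemma sum_ind_eq (F : Finset I) (i : I) : ∑ a ∈ F, ind (i = a) = ind (i ∈ F) := by
  classical
  by_cases h : i ∈ F
  · rw [Finset.sum_eq_single_of_mem i h fun b _ hb => ind_of_false (Ne.symm hb), ind_of_true rfl,
      ind_of_true h]
  · rw [ind_of_false h]
    exact Finset.sum_eq_zero fun a ha => ind_of_false fun hia => h (hia ▸ ha)

/-- If all transitions have their expected frequencies along the path `x`, then the limits of the
frequencies of the states along an ultrafilter form a subinvariant vector. -/
lemma subinvariant_of_ultrafilter (hQ : IsStochastic Q)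
    (hx : ∀ a b, Tendsto (avg fun n => ind (x n = a ∧ x (n + 1) = b)
      - (Q a b).toReal * ind (x n = a)) atTop (𝓝 0))
    {u : Ultrafilter ℕ} (hu : (u : Filter ℕ) ≤ atTop) {L : I → ℝ}
    (hL : ∀ a, Tendsto (avg fun n => ind (x n = a)) u (𝓝 (L a))) (b : I) :
    ∑' a, ENNReal.ofReal (L a) * Q a b ≤ ENNReal.ofReal (L b) := by
  have hL0 : ∀ a, 0 ≤ L a := fun a => nonneg_of_tendsto_avg_ind (hL a)
  have h1 : ∀ a, Tendsto (avg fun n => ind (x n = a ∧ x (n + 1) = b)) u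
      (𝓝 (L a * (Q a b).toReal)) := by
    intro a
    have h2 := ((hx a b).mono_left hu).add ((hL a).const_mul (Q a b).toReal)
    rw [zero_add, mul_comm] at h2
    refine h2.congr fun N => ?_
    rw [avg_sub_mul]; ring
  have h3 : Tendsto (avg fun n => ind (x (n + 1) = b)) u (𝓝 (L b)) := by
    have h4 := ((tendsto_avg_succ_sub (f := fun n => ind (x n = b)) fun n => by
      rw [abs_of_nonneg (ind_nonneg _)]; exact ind_le_one _).mono_left hu).add (hL b)
    rw [zero_add] at h4
    exact h4.congr fun N => by ring
  refine ENNReal.summable.tsum_le_of_sum_le fun F => ?_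
  have h5 : ∑ a ∈ F, L a * (Q a b).toReal ≤ L b := by
    refine le_of_tendsto_of_tendsto' (tendsto_finsetSum F fun a _ => h1 a) h3 fun N => ?_
    rw [← avg_finsetSum]
    refine avg_mono (fun n => ?_) N
    by_cases hb : x (n + 1) = b
    · simp only [hb, and_true]
      rw [sum_ind_eq, ind_of_true trivial]
      exact ind_le_one _
    · simp only [hb, and_false]
      rw [ind_of_false (p := False) id]
      simp
  calc _ = ENNReal.ofReal (∑ a ∈ F, L a * (Q a b).toReal) := by
        rw [ENNReal.ofReal_sum_of_nonneg fun a _ => mul_nonneg (hL0 a) ENNReal.toReal_nonneg]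
        refine Finset.sum_congr rfl fun a _ => ?_
        rw [ENNReal.ofReal_mul (hL0 a), ENNReal.ofReal_toReal (hQ.ne_top a b)]
    _ ≤ _ := ENNReal.ofReal_le_ofReal h5

/-- By compactness of the unit interval, all frequencies converge along an ultrafilter. -/
lemma exists_ultrafilter_limit (x : ℕ → I) (u : Ultrafilter ℕ) :
    ∃ L : I → ℝ, ∀ a, Tendsto (avg fun n => ind (x n = a)) u (𝓝 (L a)) := by
  have h : ∀ a, ∃ l : ℝ, Tendsto (avg fun n => ind (x n = a)) u (𝓝 l) := by
    intro a
    obtain ⟨l, _, hl⟩ := (isCompact_Icc (a := (0 : ℝ)) (b := 1)).ultrafilter_le_nhds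
      (u.map (avg fun n => ind (x n = a))) (by
        rw [le_principal_iff]
        exact Filter.mem_map.2 <| Filter.univ_mem' fun N => ⟨avg_nonneg (fun n => ind_nonneg _) N,
          avg_le_one (fun n => ind_le_one _) N⟩)
    exact ⟨l, hl⟩
  choose L hL using h
  exact ⟨L, hL⟩

lemma sum_ultrafilter_limit_le {u : Ultrafilter ℕ} {L : I → ℝ}
    (hL : ∀ a, Tendsto (avg fun n => ind (x n = a)) u (𝓝 (L a))) :
    ∑' a, ENNReal.ofReal (L a) ≤ 1 := by
  have hL0 : ∀ a, 0 ≤ L a := fun a => nonneg_of_tendsto_avg_ind (hL a)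
  refine ENNReal.summable.tsum_le_of_sum_le fun F => ?_
  rw [← ENNReal.ofReal_sum_of_nonneg fun a _ => hL0 a, ← ENNReal.ofReal_one]
  refine ENNReal.ofReal_le_ofReal (le_of_tendsto' (tendsto_finsetSum F fun a _ => hL a) fun N => ?_)
  rw [← avg_finsetSum]
  exact avg_le_one (fun n => by rw [sum_ind_eq]; exact ind_le_one _) N

/-- In the null recurrent case all states have frequency zero. -/
lemma tendsto_freq_of_null (hQ : IsStochastic Q) (hirr : IsIrreducibleChain Q) {a : I}
    (ha : hitProb Q a a = 1) (hm : meanReturnTime Q a = ∞)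
    (hx : ∀ a b, Tendsto (avg fun n => ind (x n = a ∧ x (n + 1) = b)
      - (Q a b).toReal * ind (x n = a)) atTop (𝓝 0)) (i : I) :
    Tendsto (avg fun n => ind (x n = i)) atTop (𝓝 0) := by
  rw [tendsto_iff_ultrafilter]
  intro u hu
  obtain ⟨L, hL⟩ := exists_ultrafilter_limit x u
  have h := eq_zero_of_subinvariant hQ hirr ha hm (sum_ultrafilter_limit_le hL)
    (subinvariant_of_ultrafilter hQ hx hu hL) i
  have hL0 : 0 ≤ L i := nonneg_of_tendsto_avg_ind (hL i)
  rw [← le_antisymm (ENNReal.ofReal_eq_zero.1 h) hL0]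
  exact hL i

/-- If the path spends little time outside large finite sets, then no mass escapes to infinity and
the frequencies converge to the stationary vector. -/
lemma tendsto_freq_of_tight (hQ : IsStochastic Q) (hirr : IsIrreducibleChain Q) {a : I}
    (ha : hitProb Q a a = 1)
    (hx : ∀ a b, Tendsto (avg fun n => ind (x n = a ∧ x (n + 1) = b)
      - (Q a b).toReal * ind (x n = a)) atTop (𝓝 0))
    (htight : ∀ ε : ℝ, 0 < ε → ∃ F : Finset I, ∀ N : ℕ,
      ∑ n ∈ Finset.range N, ind (x n ∉ F) ≤ ε * N) (i : I) :
    Tendsto (avg fun n => ind (x n = i)) atTop (𝓝 (statVec Q a i).toReal) := by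
  rw [tendsto_iff_ultrafilter]
  intro u hu
  obtain ⟨L, hL⟩ := exists_ultrafilter_limit x u
  have hL0 : ∀ a, 0 ≤ L a := fun a => nonneg_of_tendsto_avg_ind (hL a)
  have hsum : ∑' a, ENNReal.ofReal (L a) = 1 := by
    refine le_antisymm (sum_ultrafilter_limit_le hL) ?_
    have hε : ∀ ε : ℝ, 0 < ε → ENNReal.ofReal (1 - ε) ≤ ∑' a, ENNReal.ofReal (L a) := by
      intro ε hε
      obtain ⟨F, hF⟩ := htight ε hε
      refine le_trans ?_ (ENNReal.sum_le_tsum F)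
      rw [← ENNReal.ofReal_sum_of_nonneg fun a _ => hL0 a]
      refine ENNReal.ofReal_le_ofReal (ge_of_tendsto (tendsto_finsetSum F fun a _ => hL a) ?_)
      refine hu ((eventually_ge_atTop 1).mono fun N hN => ?_)
      have hN' : (0 : ℝ) < N := by exact_mod_cast hN
      rw [← avg_finsetSum]
      have h1 : avg (fun n => ∑ a ∈ F, ind (x n = a)) N + avg (fun n => ind (x n ∉ F)) N = 1 := by
        rw [← avg_add, ← avg_one (N := N) (by omega)]
        congr 1
        funext n
        rw [sum_ind_eq]
        by_cases h : x n ∈ F <;> simp [h, ind]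
      have h2 : avg (fun n => ind (x n ∉ F)) N ≤ ε := by
        rw [avg, div_le_iff₀ hN']
        exact hF N
      linarith
    have hlim : Tendsto (fun ε : ℝ => ENNReal.ofReal (1 - ε)) (𝓝[>] 0) (𝓝 1) := by
      have h1 : Tendsto (fun ε : ℝ => ENNReal.ofReal (1 - ε)) (𝓝 0) (𝓝 (ENNReal.ofReal (1 - 0))) :=
        ENNReal.tendsto_ofReal (tendsto_const_nhds.sub tendsto_id)
      simpa using h1.mono_left nhdsWithin_le_nhds
    exact le_of_tendsto hlim (eventually_nhdsWithin_of_forall fun ε hε' => hε ε hε')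
  have h := congrFun (eq_statVec hQ hirr ha hsum (subinvariant_of_ultrafilter hQ hx hu hL)) i
  rw [← h, ENNReal.toReal_ofReal (hL0 i)]
  exact hL i

end Frequencies

/-! ### Words read backward along a path -/

section Words

variable {I : Type*}

/-- The sequence `x n, x (n - 1), …, x 0` followed by `y 1, y 2, …`. -/
def glue (y x : ℕ → I) (n : ℕ) : ℕ → I := fun k => if k ≤ n then x (n - k) else y (k - n)

lemma glue_apply_zero (y x : ℕ → I) (n : ℕ) : glue y x n 0 = x n := by simp [glue]

lemma glue_succ_succ (y x : ℕ → I) (n k : ℕ) : glue y x (n + 1) (k + 1) = glue y x n k := by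
  simp [glue, Nat.succ_sub_succ]

/-- The sequence `glue y x n` starts with the word `w 0, …, w m`. -/
def HasWord (y x w : ℕ → I) (m n : ℕ) : Prop := ∀ k ≤ m, glue y x n k = w k

lemma hasWord_zero {y x w : ℕ → I} {n : ℕ} : HasWord y x w 0 n ↔ x n = w 0 := by
  simp [HasWord, glue_apply_zero]

lemma HasWord.apply_eq {y x w : ℕ → I} {m n : ℕ} (h : HasWord y x w m n) : x n = w 0 := by
  rw [← h 0 (Nat.zero_le m), glue_apply_zero]

lemma hasWord_succ {y x w : ℕ → I} {m n : ℕ} :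
    HasWord y x w (m + 1) (n + 1) ↔
      HasWord y x (fun k => w (k + 1)) m n ∧ x (n + 1) = w 0 := by
  constructor
  · intro h
    refine ⟨fun k hk => ?_, h.apply_eq⟩
    rw [← glue_succ_succ]
    exact h (k + 1) (by omega)
  · rintro ⟨h, h0⟩ k hk
    cases k with
    | zero => rw [glue_apply_zero, h0]
    | succ k => rw [glue_succ_succ]; exact h k (by omega)

lemma HasWord.congr_path {y x x' w : ℕ → I} {m n : ℕ} (hx : ∀ k ≤ n, x k = x' k)
    (h : HasWord y x w m n) : HasWord y x' w m n := by
  intro k hk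
  rw [← h k hk, glue, glue]
  split_ifs with hkn
  · rw [hx _ (Nat.sub_le n k)]
  · rfl

lemma hasWord_congr {y x w w' : ℕ → I} {m n : ℕ} (h : ∀ k ≤ m, w k = w' k) :
    HasWord y x w m n ↔ HasWord y x w' m n :=
  forall₂_congr fun k hk => by rw [h k hk]

/-- Statements about words of length `m + 1` need only be checked almost surely for each single
word. -/
lemma ae_all_words [Countable I] {Ω : Type*} [MeasurableSpace Ω] {ℙ : Measure Ω}
    {P : Ω → ℕ → (ℕ → I) → Prop}
    (hP : ∀ ω m w w', (∀ k ≤ m, w k = w' k) → P ω m w → P ω m w')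
    (h : ∀ m w, ∀ᵐ ω ∂ℙ, P ω m w) : ∀ᵐ ω ∂ℙ, ∀ m w, P ω m w := by
  refine ae_all_iff.2 fun m => ?_
  have h1 : ∀ᵐ ω ∂ℙ, ∀ v : Fin (m + 1) → I, P ω m fun k => v ⟨min k m, by omega⟩ :=
    ae_all_iff.2 fun v => h m _
  filter_upwards [h1] with ω hω w
  refine hP ω m _ w (fun k hk => ?_) (hω fun k => w k)
  simp [hk]

lemma isHist_hasWord {Ω : Type*} (X : ℕ → Ω → I) (y w : ℕ → I) (m n : ℕ) :
    IsHist X n {ω | HasWord y (fun k => X k ω) w m n} :=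
  fun _ _ h hω => HasWord.congr_path h hω

/-- From the frequencies of letters to the frequencies of words. -/
lemma tendsto_avg_hasWord {Q : Matrix I I ℝ≥0∞} {y x : ℕ → I} {π : I → ℝ≥0∞}
    (hx : ∀ (m : ℕ) (w : ℕ → I) (b : I), Tendsto
      (avg fun n => ind (HasWord y x w m n ∧ x (n + 1) = b)
        - (Q (w 0) b).toReal * ind (HasWord y x w m n)) atTop (𝓝 0))
    (hπ : ∀ i, Tendsto (avg fun n => ind (x n = i)) atTop (𝓝 (π i).toReal)) (m : ℕ) (w : ℕ → I) :
    Tendsto (avg fun n => ind (HasWord y x w m n)) atTop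
      (𝓝 ((π (w m) * ∏ k ∈ Finset.range m, Q (w (k + 1)) (w k)).toReal)) := by
  induction m generalizing w with
  | zero => simpa [hasWord_zero] using hπ (w 0)
  | succ m ih =>
    have h1 := (hx m (fun k => w (k + 1)) (w 0)).add
      ((ih fun k => w (k + 1)).const_mul (Q (w 1) (w 0)).toReal)
    have h2 := h1.sub (tendsto_avg_succ_sub (f := fun n => ind (HasWord y x w (m + 1) n)) fun n => by
      rw [abs_of_nonneg (ind_nonneg _)]; exact ind_le_one _)
    rw [sub_zero, ← ENNReal.toReal_mul] at h2
    simp only [zero_add] at h2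
    have h3 : π (w (m + 1)) * ∏ k ∈ Finset.range (m + 1), Q (w (k + 1)) (w k)
        = Q (w 1) (w 0) * (π (w (m + 1)) * ∏ k ∈ Finset.range m, Q (w (k + 1 + 1)) (w (k + 1))) := by
      rw [Finset.prod_range_succ', zero_add]
      ring
    rw [h3]
    refine h2.congr fun N => ?_
    simp_rw [hasWord_succ]
    rw [avg_sub_mul]
    ring

variable [Countable I] [MeasurableSpace I] [MeasurableSingletonClass I]
  {Ω : Type*} [MeasurableSpace Ω] {Q : Matrix I I ℝ≥0∞} {ℙ : Measure Ω} {X : ℕ → Ω → I}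

/-- Almost surely, each word is continued by each letter with the expected frequency. -/
lemma IsMarkovChain.ae_tendsto_avg_word (hX : IsMarkovChain Q ℙ X) (hQ : IsStochastic Q)
    (y : ℕ → I) : ∀ᵐ ω ∂ℙ, ∀ (m : ℕ) (w : ℕ → I) (b : I),
      Tendsto (avg fun n => ind (HasWord y (fun k => X k ω) w m n ∧ X (n + 1) ω = b)
        - (Q (w 0) b).toReal * ind (HasWord y (fun k => X k ω) w m n)) atTop (𝓝 0) := by
  refine ae_all_words (fun ω m w w' hw h b => ?_) fun m w => ae_all_iff.2 fun b => ?_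
  · have h1 := h b
    simp_rw [hasWord_congr hw, hw 0 (Nat.zero_le m)] at h1
    exact h1
  · filter_upwards [hX.ae_tendsto_average hQ (b := b) (isHist_hasWord X y w m)
      fun n ω hω => HasWord.apply_eq hω] with ω hω
    refine hω.congr fun N => ?_
    simp_rw [indicator_one_eq_ind]
    rfl

/-- Almost surely, every word which has positive probability occurs, if all states are visited
infinitely often. -/
lemma IsMarkovChain.ae_frequently_word (hX : IsMarkovChain Q ℙ X) (hQ : IsStochastic Q)
    (y : ℕ → I) (hvisit : ∀ j, ∀ᵐ ω ∂ℙ, ∃ᶠ n in atTop, X n ω = j) :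
    ∀ᵐ ω ∂ℙ, ∀ (m : ℕ) (w : ℕ → I), (∀ k < m, 0 < Q (w (k + 1)) (w k)) →
      ∃ᶠ n in atTop, HasWord y (fun k => X k ω) w m n := by
  refine ae_all_words (fun ω m w w' hw h hpos => ?_) fun m => ?_
  · simp_rw [← hasWord_congr hw]
    refine h fun k hk => ?_
    rw [hw _ hk, hw _ hk.le]
    exact hpos k hk
  · induction m with
    | zero =>
      intro w
      filter_upwards [hvisit (w 0)] with ω hω _
      simpa only [hasWord_zero] using hω
    | succ m ih =>
      intro w
      by_cases hpos : ∀ k < m + 1, 0 < Q (w (k + 1)) (w k)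
      · have h1 : ∀ᵐ ω ∂ℙ, ∃ᶠ n in atTop,
            HasWord y (fun k => X k ω) (fun k => w (k + 1)) m n := by
          filter_upwards [ih fun k => w (k + 1)] with ω hω
          exact hω fun k hk => hpos (k + 1) (by omega)
        filter_upwards [hX.ae_frequently_inter hQ (hpos 0 (by omega))
          (isHist_hasWord X y (fun k => w (k + 1)) m) (fun n ω hω => HasWord.apply_eq hω) h1]
          with ω hω _
        refine frequently_atTop.2 fun N => ?_
        obtain ⟨n, hn, h2⟩ := frequently_atTop.1 hω N
        exact ⟨n + 1, by omega, hasWord_succ.2 h2⟩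
      · exact ae_of_all _ fun ω h => absurd h hpos

end Words

/-! ### The backward matrix and the preimages of the shift -/

section ShiftSpace

variable {I : Type*} {M : Matrix I I ℕ}

lemma colSum_eq_encard (hM : ∀ i j, M i j = 0 ∨ M i j = 1) (j : I) :
    colSum M j = ENat.toENNReal ({i | M i j = 1} : Set I).encard := by
  classical
  rw [← ENNReal.tsum_set_one, tsum_subtype {i | M i j = 1} fun _ => (1 : ℝ≥0∞), colSum]
  refine tsum_congr fun i => ?_
  rcases hM i j with h | h <;> simp [h]

lemma backwardMatrix_of_ne_one (hM : ∀ i j, M i j = 0 ∨ M i j = 1) {i j : I} (h : M i j ≠ 1) :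
    backwardMatrix M j i = 0 := by
  simp [backwardMatrix, (hM i j).resolve_right h]

lemma backwardMatrix_pos (hcol : ∀ j, colSum M j < ∞) {i j : I} (h : M i j = 1) :
    0 < backwardMatrix M j i := by
  rw [backwardMatrix, h]
  exact ENNReal.div_pos (by simp) (hcol j).ne

/-- The sequence `x` with the symbol `i` put in front of it. -/
def cons (i : I) (x : ℕ → I) : ℕ → I := fun n => Nat.casesOn n i x

open Classical in
/-- The preimage of `x` under the shift that starts with `i`; the junk value is `x` if the
transition from `i` to `x 0` is forbidden. -/
noncomputable def prepend (M : Matrix I I ℕ) (i : I) (x : ShiftSpace M) : ShiftSpace M :=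
  if h : M i (x.1 0) = 1 then
    ⟨cons i x.1, fun n => by cases n with
      | zero => exact h
      | succ n => exact x.2 n⟩
  else x

lemma prepend_coe {i : I} {x : ShiftSpace M} (h : M i (x.1 0) = 1) :
    (prepend M i x).1 = cons i x.1 := by
  rw [prepend, dif_pos h]

lemma shift_prepend {i : I} {x : ShiftSpace M} (h : M i (x.1 0) = 1) :
    shift M (prepend M i x) = x := by
  apply Subtype.ext
  funext n
  change (prepend M i x).1 (n + 1) = x.1 n
  rw [prepend_coe h]
  rfl

lemma prepend_apply_zero {i : I} {x : ShiftSpace M} (h : M i (x.1 0) = 1) :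
    (prepend M i x).1 0 = i := by
  rw [prepend_coe h]; rfl

lemma shift_zero_transition {x z : ShiftSpace M} (h : shift M z = x) : M (z.1 0) (x.1 0) = 1 := by
  rw [← h]; exact z.2 0

lemma mem_image_shift_iff {j : I} {x : ShiftSpace M} :
    x ∈ shift M '' oneCylinder M j ↔ M j (x.1 0) = 1 := by
  constructor
  · rintro ⟨z, hz, rfl⟩
    rw [← show z.1 0 = j from hz]
    exact z.2 0
  · exact fun h => ⟨prepend M j x, prepend_apply_zero h, shift_prepend h⟩

lemma eq_of_shift_eq {x z z' : ShiftSpace M} (h : shift M z = x) (h' : shift M z' = x)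
    (h0 : z.1 0 = z'.1 0) : z = z' := by
  apply Subtype.ext
  funext n
  cases n with
  | zero => exact h0
  | succ n => exact congrFun (congrArg Subtype.val (h.trans h'.symm)) n

lemma encard_preimage_shift (x : ShiftSpace M) :
    (shift M ⁻¹' {x}).encard = ({i | M i (x.1 0) = 1} : Set I).encard := by
  have h : shift M ⁻¹' {x} = (fun i => prepend M i x) '' {i | M i (x.1 0) = 1} := by
    ext z
    constructor
    · intro hz
      have h1 := shift_zero_transition (show shift M z = x from hz)
      exact ⟨z.1 0, h1, eq_of_shift_eq (shift_prepend h1) hz (prepend_apply_zero h1)⟩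
    · rintro ⟨i, hi, rfl⟩
      exact shift_prepend hi
  rw [h, Set.InjOn.encard_image]
  intro i hi j hj hij
  rw [← prepend_apply_zero hi, ← prepend_apply_zero hj]
  exact congrArg (fun z => z.1 0) hij

/-- The symbols `x 0` of a random backward trajectory move according to the backward matrix. -/
lemma backwardProb_eq (hM : ∀ i j, M i j = 0 ∨ M i j = 1) {x z : ShiftSpace M}
    (h : shift M z = x) :
    backwardProb (shift M) x z = backwardMatrix M (x.1 0) (z.1 0) := by
  rw [backwardProb, Set.indicator_of_mem (show z ∈ shift M ⁻¹' {x} from h), encard_preimage_shift,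
    ← colSum_eq_encard hM, backwardMatrix, shift_zero_transition h]
  simp

lemma backwardProb_of_ne {x z : ShiftSpace M} (h : shift M z ≠ x) :
    backwardProb (shift M) x z = 0 := by
  rw [backwardProb, Set.indicator_of_notMem (show z ∉ shift M ⁻¹' {x} from h)]

lemma reflTransGen_of_transitive [TopologicalSpace I] [DiscreteTopology I]
    (hstates : ∀ i, (oneCylinder M i).Nonempty) (htrans : IsTransitive (shift M)) (i j : I) :
    Relation.ReflTransGen (fun a b => M a b = 1) i j := by
  have hopen : ∀ i, IsOpen (oneCylinder M i) := fun i =>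
    have h : Continuous fun x : ShiftSpace M => x.1 0 :=
      (continuous_apply 0).comp continuous_subtype_val
    (isOpen_discrete {i}).preimage h
  have hiter : ∀ n (x : ShiftSpace M) k, ((shift M)^[n] x).1 k = x.1 (n + k) := by
    intro n
    induction n with
    | zero => simp
    | succ n ih =>
      intro x k
      rw [Function.iterate_succ_apply, ih]
      change x.1 (n + k + 1) = x.1 (n + 1 + k)
      rw [Nat.add_right_comm]
  obtain ⟨n, _, ⟨x, hx, rfl⟩, hj⟩ := htrans _ _ (hopen i) (hstates i) (hopen j) (hstates j)
  have hj' : x.1 n = j := by rw [← hj, hiter, add_zero]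
  have hx' : x.1 0 = i := hx
  rw [← hj', ← hx']
  clear hj hj' hx hx'
  induction n with
  | zero => exact Relation.ReflTransGen.refl
  | succ n ih => exact ih.tail (x.2 n)

lemma exists_predecessor [TopologicalSpace I] [DiscreteTopology I]
    (hstates : ∀ i, (oneCylinder M i).Nonempty) (htrans : IsTransitive (shift M)) (j : I) :
    ∃ i, M i j = 1 := by
  obtain ⟨x, hx⟩ := hstates j
  rcases (reflTransGen_of_transitive hstates htrans (x.1 1) j).cases_tail with h | ⟨i, _, h⟩
  · have h1 := x.2 0
    rw [zero_add, ← h] at h1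
    exact ⟨_, h1⟩
  · exact ⟨i, h⟩

lemma isIrreducibleChain_backwardMatrix [TopologicalSpace I] [DiscreteTopology I]
    (hstates : ∀ i, (oneCylinder M i).Nonempty) (htrans : IsTransitive (shift M))
    (hcol : ∀ j, colSum M j < ∞) : IsIrreducibleChain (backwardMatrix M) := by
  intro x y
  have h := Relation.ReflTransGen.mono (p := fun a b => 0 < backwardMatrix M b a)
    (fun a b hab => backwardMatrix_pos hcol hab) _ _ (reflTransGen_of_transitive hstates htrans y x)
  exact h.swap

lemma isStochastic_backwardMatrix (hpred : ∀ j, ∃ i, M i j = 1) (hcol : ∀ j, colSum M j < ∞) :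
    IsStochastic (backwardMatrix M) := by
  intro j
  simp_rw [backwardMatrix, div_eq_mul_inv]
  rw [ENNReal.tsum_mul_right]
  refine ENNReal.mul_inv_cancel ?_ (hcol j).ne
  obtain ⟨i, hi⟩ := hpred j
  refine (lt_of_lt_of_le ?_ (ENNReal.le_tsum i)).ne'
  simp [hi]

end ShiftSpace

/-! ### Random backward trajectories -/

section Trajectories

variable {I : Type*} {M : Matrix I I ℕ}

/-- A backward trajectory is determined by its starting point and its first symbols. -/
lemma eq_glue_of_shift {y₀ : ShiftSpace M} {y : ℕ → ShiftSpace M} {n : ℕ} (h0 : y 0 = y₀)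
    (h : ∀ k < n, shift M (y (k + 1)) = y k) {k : ℕ} (hk : k ≤ n) :
    (y k).1 = glue y₀.1 (fun j => (y j).1 0) k := by
  induction k with
  | zero =>
    funext l
    cases l with
    | zero => rw [glue_apply_zero]
    | succ l => rw [h0]; simp [glue]
  | succ k ih =>
    funext l
    cases l with
    | zero => rw [glue_apply_zero]
    | succ l =>
      rw [glue_succ_succ, ← ih (by omega), ← h k (by omega)]
      rfl

lemma eq_of_symbols_eq {y₀ : ShiftSpace M} {y z : ℕ → ShiftSpace M} {n : ℕ} (hy0 : y 0 = y₀)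
    (hy : ∀ k < n, shift M (y (k + 1)) = y k) (hz0 : z 0 = y₀)
    (hz : ∀ k < n, shift M (z (k + 1)) = z k) (h : ∀ k ≤ n, (y k).1 0 = (z k).1 0) {k : ℕ}
    (hk : k ≤ n) : y k = z k := by
  apply Subtype.ext
  rw [eq_glue_of_shift hy0 hy hk, eq_glue_of_shift hz0 hz hk]
  funext l
  rw [glue, glue]
  split_ifs with hl
  · exact h _ ((Nat.sub_le k l).trans hk)
  · rfl

variable [MeasurableSpace I]

lemma measurable_symbol (n : ℕ) : Measurable fun x : ShiftSpace M => x.1 n :=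
  (measurable_pi_apply n).comp measurable_subtype_coe

lemma measurable_shift : Measurable (shift M) :=
  Measurable.subtype_mk (measurable_pi_lambda _ fun n => measurable_symbol (n + 1))

variable {Ω : Type*} [MeasurableSpace Ω] {ℙ : Measure Ω} {Y : ℕ → Ω → ShiftSpace M}
  {y₀ : ShiftSpace M}

namespace IsRandomBackwardTrajectory

/-- The probability of moving on from the history `x` to the preimage of `x n` that starts
with `i`. -/
lemma measure_step (hY : IsRandomBackwardTrajectory (shift M) y₀ ℙ Y)
    (hM : ∀ i j, M i j = 0 ∨ M i j = 1) (n : ℕ) (x : ℕ → ShiftSpace M) (i : I) :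
    ℙ ({ω | ∀ k ≤ n, Y k ω = x k} ∩ {ω | shift M (Y (n + 1) ω) = x n}
        ∩ {ω | (Y (n + 1) ω).1 0 = i})
      = ℙ {ω | ∀ k ≤ n, Y k ω = x k} * backwardMatrix M ((x n).1 0) i := by
  by_cases h : M i ((x n).1 0) = 1
  · have h1 := hY.transition n fun k => if k ≤ n then x k else prepend M i (x n)
    simp only [le_refl, if_true, Nat.not_succ_le_self, if_false] at h1
    rw [backwardProb_eq hM (shift_prepend h), prepend_apply_zero h] at h1
    have h2 : {ω | ∀ k ≤ n, Y k ω = if k ≤ n then x k else prepend M i (x n)}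
        = {ω | ∀ k ≤ n, Y k ω = x k} := by
      ext ω
      exact forall₂_congr fun k hk => by rw [if_pos hk]
    rw [h2] at h1
    rw [← h1]
    congr 1
    ext ω
    constructor
    · rintro ⟨⟨h3, h4⟩, h5⟩ k hk
      rcases Nat.le_succ_iff.1 hk with hk | rfl
      · rw [if_pos hk]; exact h3 k hk
      · rw [if_neg (by omega)]
        exact eq_of_shift_eq h4 (shift_prepend h) (h5.trans (prepend_apply_zero h).symm)
    · intro h3
      have h4 : Y (n + 1) ω = prepend M i (x n) := by simpa using h3 (n + 1) le_rfl
      refine ⟨⟨fun k hk => ?_, ?_⟩, ?_⟩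
      · have := h3 k (by omega)
        rwa [if_pos hk] at this
      · change shift M (Y (n + 1) ω) = x n
        rw [h4, shift_prepend h]
      · change (Y (n + 1) ω).1 0 = i
        rw [h4, prepend_apply_zero h]
  · rw [backwardMatrix_of_ne_one hM h, mul_zero]
    convert measure_empty (μ := ℙ)
    refine Set.eq_empty_of_forall_notMem ?_
    rintro ω ⟨⟨_, h4⟩, h5⟩
    have := shift_zero_transition h4
    rw [show (Y (n + 1) ω).1 0 = i from h5] at this
    exact h this

variable [MeasurableSingletonClass I]

lemma measurableSet_hist (hY : IsRandomBackwardTrajectory (shift M) y₀ ℙ Y) (n : ℕ)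
    (x : ℕ → ShiftSpace M) : MeasurableSet {ω | ∀ k ≤ n, Y k ω = x k} := by
  have : {ω | ∀ k ≤ n, Y k ω = x k} = ⋂ k, ⋂ (_ : k ≤ n), {ω | Y k ω = x k} := by
    ext ω; simp
  rw [this]
  exact MeasurableSet.iInter fun k => MeasurableSet.iInter fun _ =>
    hY.measurable k (measurableSet_singleton _)

variable [Countable I]

/-- Almost surely, each point of the trajectory is a preimage of the point before it. -/
lemma ae_shift (hY : IsRandomBackwardTrajectory (shift M) y₀ ℙ Y)
    (hM : ∀ i j, M i j = 0 ∨ M i j = 1) (hQ : IsStochastic (backwardMatrix M)) :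
    ∀ᵐ ω ∂ℙ, Y 0 ω = y₀ ∧ ∀ n, shift M (Y (n + 1) ω) = Y n ω := by
  have hP := hY.isProbabilityMeasure
  have h0 : ∀ᵐ ω ∂ℙ, Y 0 ω = y₀ := by
    rw [ae_iff]
    exact (prob_compl_eq_zero_iff (hY.measurable 0 (measurableSet_singleton y₀))).2 hY.initial
  have hstep : ∀ n (x : ℕ → ShiftSpace M),
      ℙ ({ω | ∀ k ≤ n, Y k ω = x k} \ {ω | shift M (Y (n + 1) ω) = x n}) = 0 := by
    intro n x
    have hB : MeasurableSet {ω | shift M (Y (n + 1) ω) = x n} :=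
      (measurable_shift.comp (hY.measurable (n + 1))) (measurableSet_singleton (x n))
    have h1 : ℙ ({ω | ∀ k ≤ n, Y k ω = x k} ∩ {ω | shift M (Y (n + 1) ω) = x n})
        = ℙ {ω | ∀ k ≤ n, Y k ω = x k} := by
      rw [measure_eq_tsum_inter ((measurable_symbol 0).comp (hY.measurable (n + 1))) ℙ
        ((hY.measurableSet_hist n x).inter hB)]
      refine (tsum_congr fun i => hY.measure_step hM n x i).trans ?_
      rw [ENNReal.tsum_mul_left, hQ, mul_one]
    have h2 := measure_inter_add_sdiff (μ := ℙ) {ω | ∀ k ≤ n, Y k ω = x k} hB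
    rw [h1] at h2
    exact (ENNReal.add_right_inj (measure_ne_top ℙ {ω | ∀ k ≤ n, Y k ω = x k})).1
      (h2.trans (add_zero _).symm)
  have hall : ∀ n, ∀ᵐ ω ∂ℙ, ∀ k < n, shift M (Y (k + 1) ω) = Y k ω := by
    intro n
    induction n with
    | zero => exact ae_of_all _ fun ω k hk => absurd hk (Nat.not_lt_zero k)
    | succ n ih =>
      -- The histories up to time `n` that satisfy the claim are countably many: they are encoded by
      -- their symbols.
      have h1 : ∀ᵐ ω ∂ℙ, ∀ v : Fin (n + 1) → I, Y 0 ω = y₀ →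
          (∀ k < n, shift M (Y (k + 1) ω) = Y k ω) → (∀ k : Fin (n + 1), (Y k ω).1 0 = v k) →
          shift M (Y (n + 1) ω) = Y n ω := by
        refine ae_all_iff.2 fun v => ?_
        by_cases hv : ∃ ω₀, Y 0 ω₀ = y₀ ∧ (∀ k < n, shift M (Y (k + 1) ω₀) = Y k ω₀) ∧
            ∀ k : Fin (n + 1), (Y k ω₀).1 0 = v k
        · obtain ⟨ω₀, h2, h3, h4⟩ := hv
          filter_upwards [measure_eq_zero_iff_ae_notMem.1 (hstep n fun k => Y k ω₀)]
            with ω hω h5 h6 h7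
          have h8 : ∀ k ≤ n, Y k ω = Y k ω₀ := fun k hk =>
            eq_of_symbols_eq (y := fun k => Y k ω) (z := fun k => Y k ω₀) h5 h6 h2 h3
              (fun k hk => (h7 ⟨k, by omega⟩).trans (h4 ⟨k, by omega⟩).symm) hk
          by_contra h9
          refine hω ⟨h8, fun h10 => h9 ?_⟩
          rw [h8 n le_rfl]
          exact h10
        · exact ae_of_all _ fun ω h5 h6 h7 => absurd ⟨ω, h5, h6, h7⟩ hv
      filter_upwards [h0, ih, h1] with ω h2 h3 h4 k hk
      rcases Nat.lt_succ_iff_lt_or_eq.1 hk with hk | rfl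
      · exact h3 k hk
      · exact h4 (fun k => (Y k ω).1 0) h2 h3 fun _ => rfl
  filter_upwards [h0, ae_all_iff.2 hall] with ω h1 h2
  exact ⟨h1, fun n => h2 (n + 1) n (Nat.lt_succ_self n)⟩

/-- The symbols of a random backward trajectory form a Markov chain. -/
lemma isMarkovChain (hY : IsRandomBackwardTrajectory (shift M) y₀ ℙ Y)
    (hM : ∀ i j, M i j = 0 ∨ M i j = 1) (hQ : IsStochastic (backwardMatrix M)) :
    IsMarkovChain (backwardMatrix M) ℙ (fun n ω => (Y n ω).1 0) := by
  have hP := hY.isProbabilityMeasure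
  have hae := hY.ae_shift hM hQ
  refine ⟨hP, fun n => (measurable_symbol 0).comp (hY.measurable n), fun n v => ?_⟩
  have hsplit : {ω | ∀ k ≤ n + 1, (Y k ω).1 0 = v k}
      = {ω | ∀ k ≤ n, (Y k ω).1 0 = v k} ∩ {ω | (Y (n + 1) ω).1 0 = v (n + 1)} := by
    ext ω
    constructor
    · exact fun h => ⟨fun k hk => h k (by omega), h (n + 1) le_rfl⟩
    · rintro ⟨h, h'⟩ k hk
      rcases Nat.le_succ_iff.1 hk with hk | rfl
      · exact h k hk
      · exact h'
  rw [hsplit]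
  by_cases hv : ∃ ω₀, (Y 0 ω₀ = y₀ ∧ ∀ k, shift M (Y (k + 1) ω₀) = Y k ω₀) ∧
      ∀ k ≤ n, (Y k ω₀).1 0 = v k
  · obtain ⟨ω₀, ⟨h1, h2⟩, h3⟩ := hv
    have hiff : ∀ᵐ ω ∂ℙ, (∀ k ≤ n, (Y k ω).1 0 = v k) ↔ ∀ k ≤ n, Y k ω = Y k ω₀ := by
      filter_upwards [hae] with ω hω
      constructor
      · intro h k hk
        exact eq_of_symbols_eq (y := fun k => Y k ω) (z := fun k => Y k ω₀) (n := n) hω.1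
          (fun k _ => hω.2 k) h1 (fun k _ => h2 k) (fun k hk => (h k hk).trans (h3 k hk).symm) hk
      · intro h k hk
        rw [h k hk, h3 k hk]
    have e1 : ℙ {ω | ∀ k ≤ n, (Y k ω).1 0 = v k} = ℙ {ω | ∀ k ≤ n, Y k ω = Y k ω₀} := by
      refine measure_congr ?_
      filter_upwards [hiff] with ω hω
      exact propext hω
    have e2 : ℙ ({ω | ∀ k ≤ n, (Y k ω).1 0 = v k} ∩ {ω | (Y (n + 1) ω).1 0 = v (n + 1)})
        = ℙ ({ω | ∀ k ≤ n, Y k ω = Y k ω₀} ∩ {ω | shift M (Y (n + 1) ω) = Y n ω₀}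
          ∩ {ω | (Y (n + 1) ω).1 0 = v (n + 1)}) := by
      refine measure_congr ?_
      filter_upwards [hiff, hae] with ω hω hω'
      refine propext ⟨?_, ?_⟩
      · rintro ⟨h4, h5⟩
        have h6 := hω.1 h4
        exact ⟨⟨h6, (hω'.2 n).trans (h6 n le_rfl)⟩, h5⟩
      · rintro ⟨⟨h4, _⟩, h5⟩
        exact ⟨hω.2 h4, h5⟩
    rw [e1, e2, ← h3 n le_rfl]
    exact hY.measure_step hM n (fun k => Y k ω₀) (v (n + 1))
  · have e1 : ℙ {ω | ∀ k ≤ n, (Y k ω).1 0 = v k} = 0 := by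
      rw [measure_eq_zero_iff_ae_notMem]
      filter_upwards [hae] with ω hω h
      exact hv ⟨ω, hω, h⟩
    rw [e1, zero_mul]
    exact measure_mono_null Set.inter_subset_left e1

lemma ae_eq_glue (hY : IsRandomBackwardTrajectory (shift M) y₀ ℙ Y)
    (hM : ∀ i j, M i j = 0 ∨ M i j = 1) (hQ : IsStochastic (backwardMatrix M)) :
    ∀ᵐ ω ∂ℙ, ∀ n, (Y n ω).1 = glue y₀.1 (fun j => (Y j ω).1 0) n := by
  filter_upwards [hY.ae_shift hM hQ] with ω hω n
  exact eq_glue_of_shift (y := fun k => Y k ω) hω.1 (fun k _ => hω.2 k) le_rfl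

end IsRandomBackwardTrajectory

variable [Countable I] [MeasurableSingletonClass I]

lemma measurable_prepend (i : I) : Measurable (prepend M i) := by
  classical
  have h : Measurable fun x : ShiftSpace M => (prepend M i x).1 := by
    have h1 : (fun x : ShiftSpace M => (prepend M i x).1)
        = fun x => if M i (x.1 0) = 1 then cons i x.1 else x.1 := by
      funext x
      rw [prepend]
      split_ifs <;> rfl
    rw [h1]
    refine Measurable.ite ?_ ?_ measurable_subtype_coe
    · exact measurable_symbol 0 (Set.to_countable {a : I | M i a = 1}).measurableSet
    · refine measurable_pi_lambda _ fun n => ?_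
      cases n with
      | zero => exact measurable_const
      | succ n => exact measurable_symbol n
  have h2 := h.subtype_mk (p := fun x : ℕ → I => ∀ n, M (x n) (x (n + 1)) = 1)
    (h := fun x => (prepend M i x).2)
  exact h2

/-- Random backward trajectories exist. -/
lemma exists_isRandomBackwardTrajectory (hM : ∀ i j, M i j = 0 ∨ M i j = 1)
    (hQ : IsStochastic (backwardMatrix M)) (y₀ : ShiftSpace M) :
    ∃ ℙ : Measure (ℕ → ShiftSpace M),
      IsRandomBackwardTrajectory (shift M) y₀ ℙ (fun n y => y n) := by
  classical
  have happly : ∀ (x : ShiftSpace M) {s : Set (ShiftSpace M)}, MeasurableSet s →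
      Measure.sum (fun i => backwardMatrix M (x.1 0) i • Measure.dirac (prepend M i x)) s
        = ∑' i, backwardMatrix M (x.1 0) i * s.indicator 1 (prepend M i x) := by
    intro x s hs
    rw [Measure.sum_apply _ hs]
    simp [Measure.dirac_apply' _ hs]
  let κ : ProbabilityTheory.Kernel (ShiftSpace M) (ShiftSpace M) :=
    ⟨fun x => Measure.sum fun i => backwardMatrix M (x.1 0) i • Measure.dirac (prepend M i x), by
      refine Measure.measurable_of_measurable_coe _ fun s hs => ?_
      simp_rw [happly _ hs]
      refine Measurable.tsum fun i => ?_
      refine Measurable.mul ?_ ((measurable_one.indicator hs).comp (measurable_prepend i))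
      exact (measurable_of_countable fun a => backwardMatrix M a i).comp (measurable_symbol 0)⟩
  have hκ : ProbabilityTheory.IsMarkovKernel κ := ⟨fun x => ⟨by
    change Measure.sum _ Set.univ = 1
    rw [happly x MeasurableSet.univ]
    simpa using hQ (x.1 0)⟩⟩
  obtain ⟨ℙ, h1, h2, h3⟩ := exists_pathMeasure (Measure.dirac y₀) κ
  refine ⟨ℙ, h1, fun n => measurable_pi_apply n, ?_, fun n x => ?_⟩
  · rw [h2, Measure.dirac_apply' _ (measurableSet_singleton _)]
    simp
  · rw [h3]
    congr 1
    change Measure.sum _ {x (n + 1)} = _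
    rw [happly _ (measurableSet_singleton _)]
    by_cases h : shift M (x (n + 1)) = x n
    · rw [backwardProb_eq hM h, tsum_eq_single ((x (n + 1)).1 0)]
      · have h4 := shift_zero_transition h
        rw [Set.indicator_of_mem, Pi.one_apply, mul_one]
        exact eq_of_shift_eq (shift_prepend h4) h (prepend_apply_zero h4)
      · intro i hi
        by_cases hMi : M i ((x n).1 0) = 1
        · rw [Set.indicator_of_notMem, mul_zero]
          intro h4
          refine hi ?_
          rw [← show prepend M i (x n) = x (n + 1) from h4, prepend_apply_zero hMi]
        · rw [backwardMatrix_of_ne_one hM hMi, zero_mul]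
    · rw [backwardProb_of_ne h, ENNReal.tsum_eq_zero]
      intro i
      by_cases hMi : M i ((x n).1 0) = 1
      · rw [Set.indicator_of_notMem, mul_zero]
        intro h4
        refine h ?_
        rw [← show prepend M i (x n) = x (n + 1) from h4, shift_prepend hMi]
      · rw [backwardMatrix_of_ne_one hM hMi, zero_mul]

end Trajectories

/-! ### The Markov measure and its fairness -/

section MarkovMeasure

variable {I : Type*} {M : Matrix I I ℕ}

/-- The points of the shift space that start with the word `w 0, …, w m`. -/
def wordCylinder (M : Matrix I I ℕ) (m : ℕ) (w : ℕ → I) : Set (ShiftSpace M) :=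
  {x | ∀ k ≤ m, x.1 k = w k}

/-- The matrix obtained from the transition matrix `Q` with stationary vector `π` by reversing
time. -/
noncomputable def reversedMatrix (π : I → ℝ≥0∞) (Q : Matrix I I ℝ≥0∞) : Matrix I I ℝ≥0∞ :=
  fun i j => π j * Q j i / π i

lemma isStochastic_reversedMatrix {π : I → ℝ≥0∞} {Q : Matrix I I ℝ≥0∞}
    (hπ : IsStationaryVector π Q) (hpos : ∀ i, 0 < π i) : IsStochastic (reversedMatrix π Q) := by
  intro i
  simp_rw [reversedMatrix, div_eq_mul_inv]
  rw [ENNReal.tsum_mul_right, hπ.2, ENNReal.mul_inv_cancel (hpos i).ne' (hπ.ne_top i)]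

lemma mul_reversedMatrix {π : I → ℝ≥0∞} {Q : Matrix I I ℝ≥0∞}
    (hπ : IsStationaryVector π Q) (hpos : ∀ i, 0 < π i) (i j : I) :
    π i * reversedMatrix π Q i j = π j * Q j i :=
  ENNReal.mul_div_cancel (hpos i).ne' (hπ.ne_top i)

/-- Reversing time turns the probability of a word into that of the reversed word. -/
lemma reversed_word {π : I → ℝ≥0∞} {P Q : Matrix I I ℝ≥0∞} (h : ∀ i j, π i * P i j = π j * Q j i)
    (m : ℕ) (w : ℕ → I) :
    π (w 0) * ∏ k ∈ Finset.range m, P (w k) (w (k + 1))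
      = π (w m) * ∏ k ∈ Finset.range m, Q (w (k + 1)) (w k) := by
  induction m with
  | zero => simp
  | succ m ih =>
    rw [Finset.prod_range_succ, ← mul_assoc, ih, Finset.prod_range_succ, mul_right_comm, h]
    ring

lemma IsMarkovMeasure.measure_oneCylinder [MeasurableSpace I] {μ : Measure (ShiftSpace M)} {π : I → ℝ≥0∞}
    {P : Matrix I I ℝ≥0∞} (hμ : IsMarkovMeasure M μ π P) (i : I) :
    μ (oneCylinder M i) = π i := by
  have h := hμ 0 fun _ => i
  simpa [oneCylinder] using h

variable [MeasurableSpace I] [MeasurableSingletonClass I]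

lemma measurableSet_wordCylinder (m : ℕ) (w : ℕ → I) : MeasurableSet (wordCylinder M m w) := by
  have : wordCylinder M m w = ⋂ k, ⋂ (_ : k ≤ m), {x : ShiftSpace M | x.1 k = w k} := by
    ext x; simp [wordCylinder]
  rw [this]
  exact MeasurableSet.iInter fun k => MeasurableSet.iInter fun _ =>
    measurable_symbol k (measurableSet_singleton _)

lemma measurableSet_oneCylinder (i : I) : MeasurableSet (oneCylinder M i) :=
  measurable_symbol 0 (measurableSet_singleton i)

variable [Countable I]

lemma measurableSet_admissible (M : Matrix I I ℕ) :
    MeasurableSet {x : ℕ → I | ∀ n, M (x n) (x (n + 1)) = 1} := by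
  rw [Set.ofPred_forall]
  refine MeasurableSet.iInter fun n => ?_
  have h : Measurable fun x : ℕ → I => (x n, x (n + 1)) :=
    (measurable_pi_apply n).prodMk (measurable_pi_apply (n + 1))
  exact h (Set.to_countable {p : I × I | M p.1 p.2 = 1}).measurableSet

lemma exists_isMarkovMeasure {π : I → ℝ≥0∞} {P : Matrix I I ℝ≥0∞} (hπ : ∑' i, π i = 1)
    (hP : IsStochastic P) (hPM : ∀ i j, M i j ≠ 1 → P i j = 0) :
    ∃ μ : Measure (ShiftSpace M), IsMarkovMeasure M μ π P := by
  obtain ⟨ρ, hρ, h0⟩ := exists_isMarkovChain hP hπ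
  have hae : ∀ᵐ x ∂ρ, ∀ n, M (x n) (x (n + 1)) = 1 := by
    have h1 : ∀ᵐ x ∂ρ, ∀ (n : ℕ) (p : I × I), M p.1 p.2 ≠ 1 → ¬(x n = p.1 ∧ x (n + 1) = p.2) := by
      refine ae_all_iff.2 fun n => ae_all_iff.2 fun p => ?_
      by_cases hp : M p.1 p.2 = 1
      · exact ae_of_all _ fun x h => absurd hp h
      · have h2 := hρ.measure_inter (isHist_univ _ n) p.1 p.2
        rw [hPM _ _ hp, mul_zero, Set.univ_inter] at h2
        filter_upwards [measure_eq_zero_iff_ae_notMem.1 h2] with x hx _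
        exact hx
    filter_upwards [h1] with x hx n
    by_contra h
    exact hx n (x n, x (n + 1)) h ⟨rfl, rfl⟩
  have hemb : MeasurableEmbedding (Subtype.val : ShiftSpace M → ℕ → I) :=
    MeasurableEmbedding.subtype_coe (measurableSet_admissible M)
  refine ⟨ρ.comap Subtype.val, fun m w => ?_⟩
  rw [hemb.comap_apply, ← h0, ← hρ.measure_cylinder m w]
  refine measure_congr ?_
  filter_upwards [hae] with x hx
  refine propext ⟨?_, fun h => ⟨⟨x, hx⟩, h, rfl⟩⟩
  rintro ⟨y, hy, rfl⟩
  exact hy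

lemma ext_of_wordCylinder {μ ν : Measure (ShiftSpace M)} [IsFiniteMeasure μ] [IsFiniteMeasure ν]
    (h : ∀ m w, μ (wordCylinder M m w) = ν (wordCylinder M m w)) : μ = ν := by
  have hemb : MeasurableEmbedding (Subtype.val : ShiftSpace M → ℕ → I) :=
    MeasurableEmbedding.subtype_coe (measurableSet_admissible M)
  have h1 : μ.map Subtype.val = ν.map (Subtype.val : ShiftSpace M → ℕ → I) := by
    refine ext_of_cylinder fun m w => ?_
    rw [hemb.map_apply, hemb.map_apply]
    exact h m w
  rw [← hemb.comap_map μ, h1, hemb.comap_map]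

namespace IsMarkovMeasure

variable {μ : Measure (ShiftSpace M)} {π : I → ℝ≥0∞} {P : Matrix I I ℝ≥0∞}

lemma isProbabilityMeasure (hμ : IsMarkovMeasure M μ π P) (hπ : ∑' i, π i = 1) :
    IsProbabilityMeasure μ := ⟨by
  rw [measure_eq_tsum_inter (measurable_symbol 0) μ MeasurableSet.univ, ← hπ]
  refine tsum_congr fun i => ?_
  rw [Set.univ_inter]
  exact hμ.measure_oneCylinder i⟩

/-- The Markov measure splits its mass on a set `B ⊆ [k]` among the preimage branches of `B`
according to the backward matrix. Both sides are measures in `B`, and they agree on cylinder sets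
because `P` is the time reversal of `Q`. -/
lemma measure_branch (hμ : IsMarkovMeasure M μ π P) (hπ : ∑' i, π i = 1)
    (hQ : IsStochastic (backwardMatrix M)) (hP : ∀ i j, π i * P i j = π j * backwardMatrix M j i)
    (i k : I) {B : Set (ShiftSpace M)} (hB : MeasurableSet B) :
    μ (shift M ⁻¹' (B ∩ oneCylinder M k) ∩ oneCylinder M i)
      = backwardMatrix M k i * μ (B ∩ oneCylinder M k) := by
  have := hμ.isProbabilityMeasure hπ
  have hf : IsFiniteMeasure (backwardMatrix M k i • μ.restrict (oneCylinder M k)) :=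
    Measure.smul_finite _ (hQ.ne_top k i)
  have happly : ∀ {B : Set (ShiftSpace M)}, MeasurableSet B →
      (μ.restrict (shift M ⁻¹' oneCylinder M k ∩ oneCylinder M i)).map (shift M) B
        = μ (shift M ⁻¹' (B ∩ oneCylinder M k) ∩ oneCylinder M i) := fun hB => by
    rw [Measure.map_apply measurable_shift hB, Measure.restrict_apply (measurable_shift hB),
      Set.preimage_inter, Set.inter_assoc]
  have h : (μ.restrict (shift M ⁻¹' oneCylinder M k ∩ oneCylinder M i)).map (shift M)
      = backwardMatrix M k i • μ.restrict (oneCylinder M k) := by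
    refine ext_of_wordCylinder fun m w => ?_
    rw [happly (measurableSet_wordCylinder m w), Measure.smul_apply,
      Measure.restrict_apply (measurableSet_wordCylinder m w), smul_eq_mul]
    by_cases hk : w 0 = k
    · have h1 : wordCylinder M m w ∩ oneCylinder M k = wordCylinder M m w :=
        Set.inter_eq_left.2 fun x hx => (hx 0 (Nat.zero_le m)).trans hk
      have h2 : shift M ⁻¹' wordCylinder M m w ∩ oneCylinder M i
          = {x | ∀ k ≤ m + 1, x.1 k = cons i w k} := by
        ext x
        constructor
        · rintro ⟨h, h'⟩ k hk
          cases k with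
          | zero => exact h'
          | succ k => exact h k (by omega)
        · exact fun h => ⟨fun k hk => h (k + 1) (by omega), h 0 (by omega)⟩
      rw [h1, h2, hμ (m + 1), Finset.prod_range_succ']
      have h3 := hμ m w
      rw [wordCylinder, h3, ← hk]
      change π i * ((∏ k ∈ Finset.range m, P (w k) (w (k + 1))) * P i (w 0)) = _
      rw [mul_left_comm, hP]
      ring
    · have h1 : wordCylinder M m w ∩ oneCylinder M k = ∅ :=
        Set.eq_empty_of_forall_notMem fun x hx =>
          hk ((hx.1 0 (Nat.zero_le m)).symm.trans hx.2)
      rw [h1, Set.preimage_empty, Set.empty_inter, measure_empty, mul_zero]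
  rw [← happly hB, h, Measure.smul_apply, Measure.restrict_apply hB, smul_eq_mul]

/-- The Markov measure is fair. -/
lemma isFairMeasure (hμ : IsMarkovMeasure M μ π P) (hπ : ∑' i, π i = 1)
    (hM : ∀ i j, M i j = 0 ∨ M i j = 1)
    (hQ : IsStochastic (backwardMatrix M)) (hP : ∀ i j, π i * P i j = π j * backwardMatrix M j i) :
    IsFairMeasure (shift M) (oneCylinder M) μ := by
  have hprob := hμ.isProbabilityMeasure hπ
  have hsplit : ∀ i {B : Set (ShiftSpace M)}, MeasurableSet B →
      μ (shift M ⁻¹' B ∩ oneCylinder M i)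
        = ∑' k, backwardMatrix M k i * μ (B ∩ oneCylinder M k) := by
    intro i B hB
    rw [measure_eq_tsum_inter ((measurable_symbol 0).comp measurable_shift) μ
      ((measurable_shift hB).inter (measurableSet_oneCylinder i))]
    refine tsum_congr fun k => ?_
    rw [← hμ.measure_branch hπ hQ hP i k hB, Set.inter_right_comm]
    rfl
  refine ⟨hprob, ⟨measurable_shift, Measure.ext fun B hB => ?_⟩, fun B hB hBA i hi => ?_⟩
  · rw [Measure.map_apply measurable_shift hB,
      measure_eq_tsum_inter (measurable_symbol 0) μ (measurable_shift hB)]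
    refine (tsum_congr fun i => hsplit i hB).trans ?_
    rw [ENNReal.tsum_comm, measure_eq_tsum_inter (measurable_symbol 0) μ hB]
    refine tsum_congr fun k => ?_
    rw [ENNReal.tsum_mul_right, hQ, one_mul]
    rfl
  · rw [Set.inter_comm, hsplit i hB, div_eq_mul_inv,
      measure_eq_tsum_inter (measurable_symbol 0) μ hB, ← ENNReal.tsum_mul_right]
    refine tsum_congr fun k => ?_
    rcases (B ∩ oneCylinder M k).eq_empty_or_nonempty with he | ⟨x, hxB, hxk⟩
    · change _ = μ (B ∩ oneCylinder M k) * _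
      rw [he]; simp
    · have hxk' : x.1 0 = k := hxk
      have h1 : {j | B ⊆ shift M '' oneCylinder M j} = {j | M j k = 1} := by
        ext j
        constructor
        · intro h
          rw [← hxk']
          exact mem_image_shift_iff.1 (h hxB)
        · intro h
          refine (hBA j).resolve_right fun hd => Set.disjoint_left.1 hd hxB ?_
          rw [mem_image_shift_iff, hxk']
          exact h
      have h2 : M i k = 1 := by
        rw [← hxk']; exact mem_image_shift_iff.1 (hi hxB)
      rw [h1, ← colSum_eq_encard hM, backwardMatrix, h2, mul_comm, Nat.cast_one, one_div]
      rfl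

end IsMarkovMeasure

end MarkovMeasure

/-! ### Equidistribution and density in terms of cylinder sets -/

section Equidistribution

variable {I : Type*} {M : Matrix I I ℕ}

lemma empiricalMeasure_real {X : Type*} [MeasurableSpace X] (y : ℕ → X) (N : ℕ)
    {s : Set X} (hs : MeasurableSet s) : (empiricalMeasure y N).real s = avg (fun n => ind (y n ∈ s)) N := by
  classical
  rw [measureReal_def, empiricalMeasure, Measure.smul_apply, smul_eq_mul, ENNReal.toReal_mul,
    Measure.finsetSum_apply, ENNReal.toReal_sum, avg, div_eq_mul_inv, mul_comm,
    ENNReal.toReal_inv, ENNReal.toReal_natCast]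
  · congr 1
    refine Finset.sum_congr rfl fun n _ => ?_
    rw [Measure.dirac_apply' _ hs]
    by_cases h : y n ∈ s <;> simp [h, ind]
  · intro n _
    exact measure_ne_top _ _

lemma isProbabilityMeasure_empiricalMeasure {X : Type*} [MeasurableSpace X] (y : ℕ → X) {N : ℕ} (hN : N ≠ 0) :
    IsProbabilityMeasure (empiricalMeasure y N) := ⟨by
  rw [empiricalMeasure, Measure.smul_apply, smul_eq_mul, Measure.finsetSum_apply]
  simp only [measure_univ, Finset.sum_const, Finset.card_range, nsmul_eq_mul, mul_one]
  exact ENNReal.inv_mul_cancel (by exact_mod_cast hN) (ENNReal.natCast_ne_top N)⟩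

lemma isPiSystem_wordCylinder :
    IsPiSystem {s : Set (ShiftSpace M) | ∃ m w, s = wordCylinder M m w} := by
  rintro _ ⟨m, w, rfl⟩ _ ⟨m', w', rfl⟩ ⟨x, hx, hx'⟩
  refine ⟨max m m', x.1, ?_⟩
  ext z
  constructor
  · rintro ⟨hz, hz'⟩ k hk
    rcases le_max_iff.1 hk with hk | hk
    · exact (hz k hk).trans (hx k hk).symm
    · exact (hz' k hk).trans (hx' k hk).symm
  · intro hz
    exact ⟨fun k hk => (hz k (le_max_of_le_left hk)).trans (hx k hk),
      fun k hk => (hz k (le_max_of_le_right hk)).trans (hx' k hk)⟩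

variable [TopologicalSpace I] [DiscreteTopology I]

lemma isOpen_wordCylinder (m : ℕ) (w : ℕ → I) : IsOpen (wordCylinder M m w) := by
  have h : wordCylinder M m w = Subtype.val ⁻¹' PiNat.cylinder w (m + 1) := by
    ext x
    simp only [wordCylinder, Set.mem_preimage, PiNat.mem_cylinder_iff, Nat.lt_succ_iff]
    rfl
  rw [h]
  exact (PiNat.isOpen_cylinder _ w (m + 1)).preimage continuous_subtype_val

lemma exists_wordCylinder_subset {U : Set (ShiftSpace M)} (hU : IsOpen U) {x : ShiftSpace M}
    (hx : x ∈ U) : ∃ m, wordCylinder M m x.1 ⊆ U := by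
  obtain ⟨V, hV, rfl⟩ := isOpen_induced_iff.1 hU
  obtain ⟨_, ⟨y, n, rfl⟩, hxy, hsub⟩ :=
    (PiNat.isTopologicalBasis_cylinders fun _ : ℕ => I).exists_subset_of_mem_open
      (show x.1 ∈ V from hx) hV
  refine ⟨n, fun z hz => hsub ?_⟩
  rw [PiNat.mem_cylinder_iff] at hxy ⊢
  exact fun i hi => (hz i hi.le).trans (hxy i hi)

lemma dense_range_of_wordCylinder {y : ℕ → ShiftSpace M}
    (h : ∀ m (x : ShiftSpace M), ∃ n, y n ∈ wordCylinder M m x.1) : Dense (Set.range y) := by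
  rw [dense_iff_inter_open]
  rintro U hU ⟨x, hx⟩
  obtain ⟨m, hm⟩ := exists_wordCylinder_subset hU hx
  obtain ⟨n, hn⟩ := h m x
  exact ⟨y n, hm hn, n, rfl⟩

variable [Countable I] [MeasurableSpace I] [BorelSpace I]

/-- Convergence of the frequencies of all cylinder sets implies equidistribution. -/
lemma equidistributes_of_wordCylinder {y : ℕ → ShiftSpace M} {μ : Measure (ShiftSpace M)}
    [IsProbabilityMeasure μ]
    (h : ∀ m w, Tendsto (avg fun n => ind (y n ∈ wordCylinder M m w)) atTop
      (𝓝 (μ.real (wordCylinder M m w)))) : Equidistributes y μ := by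
  have : SecondCountableTopology (ShiftSpace M) :=
    TopologicalSpace.Subtype.secondCountableTopology _
  let ν : ℕ → ProbabilityMeasure (ShiftSpace M) := fun N =>
    ⟨empiricalMeasure y (N + 1), isProbabilityMeasure_empiricalMeasure y N.succ_ne_zero⟩
  have hν : Tendsto ν atTop (𝓝 (⟨μ, inferInstance⟩ : ProbabilityMeasure (ShiftSpace M))) := by
    refine isPiSystem_wordCylinder.tendsto_probabilityMeasure_of_tendsto_of_mem ?_ ?_ ?_
    · rintro _ ⟨m, w, rfl⟩
      exact measurableSet_wordCylinder m w
    · intro U hU x hx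
      obtain ⟨m, hm⟩ := exists_wordCylinder_subset hU hx
      exact ⟨_, ⟨m, x.1, rfl⟩, (isOpen_wordCylinder m x.1).mem_nhds fun _ _ => rfl, hm⟩
    · rintro _ ⟨m, w, rfl⟩
      rw [← NNReal.tendsto_coe]
      have h1 := (h m w).comp (tendsto_add_atTop_nat 1)
      refine h1.congr fun N => ?_
      exact (empiricalMeasure_real y (N + 1) (measurableSet_wordCylinder m w)).symm
  intro φ
  have h1 := (ProbabilityMeasure.tendsto_iff_forall_integral_tendsto.1 hν) φ
  exact (tendsto_add_atTop_iff_nat (f := fun N => ∫ x, φ x ∂(empiricalMeasure y N)) 1).1 h1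

end Equidistribution

/-! ### Almost sure behaviour of random backward trajectories -/

section Backward

variable {I : Type*} {M : Matrix I I ℕ} [Countable I] [MeasurableSpace I]
  [MeasurableSingletonClass I] {Ω : Type*} [MeasurableSpace Ω] {ℙ : Measure Ω}
  {Y : ℕ → Ω → ShiftSpace M} {y₀ : ShiftSpace M}

namespace IsRandomBackwardTrajectory

/-- The trajectory lies in a word cylinder at time `n` exactly when its symbols spell the reversed
word up to time `n`. -/
lemma ae_mem_wordCylinder_iff (hY : IsRandomBackwardTrajectory (shift M) y₀ ℙ Y)
    (hM : ∀ i j, M i j = 0 ∨ M i j = 1) (hQ : IsStochastic (backwardMatrix M)) :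
    ∀ᵐ ω ∂ℙ, ∀ m w n, Y n ω ∈ wordCylinder M m w ↔
      HasWord y₀.1 (fun k => (Y k ω).1 0) w m n := by
  filter_upwards [hY.ae_eq_glue hM hQ] with ω hω m w n
  rw [HasWord, ← hω n]
  rfl

/-- All transitions between symbols have their expected frequencies. -/
lemma ae_tendsto_avg_transition (hY : IsRandomBackwardTrajectory (shift M) y₀ ℙ Y)
    (hM : ∀ i j, M i j = 0 ∨ M i j = 1) (hQ : IsStochastic (backwardMatrix M)) :
    ∀ᵐ ω ∂ℙ, ∀ a b, Tendsto (avg fun n => ind ((Y n ω).1 0 = a ∧ (Y (n + 1) ω).1 0 = b)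
      - (backwardMatrix M a b).toReal * ind ((Y n ω).1 0 = a)) atTop (𝓝 0) := by
  filter_upwards [(hY.isMarkovChain hM hQ).ae_tendsto_avg_word hQ y₀.1] with ω hω a b
  simpa only [hasWord_zero] using hω 0 (fun _ => a) b

lemma ae_equidistributes (hY : IsRandomBackwardTrajectory (shift M) y₀ ℙ Y)
    [TopologicalSpace I] [DiscreteTopology I] [BorelSpace I]
    (hM : ∀ i j, M i j = 0 ∨ M i j = 1) (hQ : IsStochastic (backwardMatrix M))
    (hirr : IsIrreducibleChain (backwardMatrix M)) {a : I}
    (ha : hitProb (backwardMatrix M) a a = 1) {π : I → ℝ≥0∞} {P : Matrix I I ℝ≥0∞}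
    (hπ : IsStationaryVector π (backwardMatrix M)) (hpos : ∀ i, 0 < π i)
    (hP : ∀ i j, π i * P i j = π j * backwardMatrix M j i)
    {μ : Measure (ShiftSpace M)} (hμ : IsMarkovMeasure M μ π P) :
    ∀ᵐ ω ∂ℙ, Equidistributes (fun n => Y n ω) μ := by
  have hprob := hY.isProbabilityMeasure
  have hprob' := hμ.isProbabilityMeasure hπ.1
  have hX := hY.isMarkovChain hM hQ
  have hπa : π = statVec (backwardMatrix M) a :=
    eq_statVec hQ hirr ha hπ.1 fun y => (hπ.2 y).le
  have hX0 : ℙ {ω | (Y 0 ω).1 0 = y₀.1 0} = 1 := by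
    refine le_antisymm prob_le_one ?_
    rw [← hY.initial]
    refine measure_mono fun ω hω => ?_
    rw [Set.mem_ofPred_eq, show Y 0 ω = y₀ from hω]
  have htight : ∀ᵐ ω ∂ℙ, ∀ j : ℕ, ∃ F : Finset I, ∀ N : ℕ,
      ∑ n ∈ Finset.range N, ((F : Set I)ᶜ).indicator (1 : I → ℝ) ((Y n ω).1 0)
        ≤ 1 / ((j : ℝ) + 1) * N :=
    ae_all_iff.2 fun j => hX.ae_exists_finset hQ hπ (hpos (y₀.1 0)) hX0 (by positivity)
  filter_upwards [hY.ae_mem_wordCylinder_iff hM hQ, hY.ae_tendsto_avg_transition hM hQ,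
    hX.ae_tendsto_avg_word hQ y₀.1, htight] with ω h1 h2 h3 h4
  refine equidistributes_of_wordCylinder fun m w => ?_
  have hstate := tendsto_freq_of_tight (x := fun n => (Y n ω).1 0) hQ hirr ha h2 fun ε hε => by
    obtain ⟨j, hj⟩ := exists_nat_one_div_lt hε
    obtain ⟨F, hF⟩ := h4 j
    refine ⟨F, fun N => ?_⟩
    calc _ = ∑ n ∈ Finset.range N, ((F : Set I)ᶜ).indicator (1 : I → ℝ) ((Y n ω).1 0) := by
          refine Finset.sum_congr rfl fun n _ => ?_
          rw [indicator_one_eq_ind]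
          rfl
      _ ≤ _ := (hF N).trans (by gcongr)
  rw [← hπa] at hstate
  have hw := tendsto_avg_hasWord h3 hstate m w
  rw [← reversed_word hP, ← hμ m w] at hw
  simp_rw [h1]
  exact hw

lemma ae_dense (hY : IsRandomBackwardTrajectory (shift M) y₀ ℙ Y)
    [TopologicalSpace I] [DiscreteTopology I]
    (hM : ∀ i j, M i j = 0 ∨ M i j = 1) (hcol : ∀ j, colSum M j < ∞)
    (hQ : IsStochastic (backwardMatrix M)) (hhit : ∀ j x, hitProb (backwardMatrix M) j x = 1) :
    ∀ᵐ ω ∂ℙ, Dense (Set.range fun n => Y n ω) := by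
  have hX := hY.isMarkovChain hM hQ
  filter_upwards [hY.ae_mem_wordCylinder_iff hM hQ,
    hX.ae_frequently_word hQ y₀.1 fun j => hX.ae_frequently_eq (hhit j)] with ω h1 h2
  refine dense_range_of_wordCylinder fun m x => ?_
  obtain ⟨n, hn⟩ := (h2 m x.1 fun k _ => backwardMatrix_pos hcol (x.2 k)).exists
  exact ⟨n, (h1 m x.1 n).2 hn⟩

lemma ae_hasLimitingFrequency_zero (hY : IsRandomBackwardTrajectory (shift M) y₀ ℙ Y)
    (hM : ∀ i j, M i j = 0 ∨ M i j = 1) (hQ : IsStochastic (backwardMatrix M))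
    (hirr : IsIrreducibleChain (backwardMatrix M)) {a : I}
    (ha : hitProb (backwardMatrix M) a a = 1) (hm : meanReturnTime (backwardMatrix M) a = ∞) :
    ∀ᵐ ω ∂ℙ, ∀ i, HasLimitingFrequency (fun n => Y n ω) (oneCylinder M i) 0 := by
  classical
  filter_upwards [hY.ae_tendsto_avg_transition hM hQ] with ω hω i
  refine (tendsto_freq_of_null hQ hirr ha hm hω i).congr fun N => ?_
  simp only [avg, ind, Finset.sum_boole]
  congr! 3

lemma ae_finite_visits (hY : IsRandomBackwardTrajectory (shift M) y₀ ℙ Y)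
    (hM : ∀ i j, M i j = 0 ∨ M i j = 1) (hQ : IsStochastic (backwardMatrix M))
    (htr : ∀ i, hitProb (backwardMatrix M) i i < 1) :
    ∀ᵐ ω ∂ℙ, ∀ i, {n : ℕ | Y n ω ∈ oneCylinder M i}.Finite := by
  have hX := hY.isMarkovChain hM hQ
  filter_upwards [ae_all_iff.2 fun i => hX.ae_eventually_ne hQ (htr i)] with ω hω i
  have h := hω i
  rw [← Nat.cofinite_eq_atTop, eventually_cofinite] at h
  simpa [oneCylinder] using h

end IsRandomBackwardTrajectory

end Backward

end CMS

theorem mainTheorem2 {I : Type*} [Countable I] [Nonempty I]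
    [TopologicalSpace I] [DiscreteTopology I] [MeasurableSpace I] [BorelSpace I]
    (M : Matrix I I ℕ)
    (hM : ∀ i j, M i j = 0 ∨ M i j = 1)
    (hstates : ∀ i, (oneCylinder M i).Nonempty)
    (htrans : IsTransitive (shift M))
    (hcol : ∀ j, colSum M j < ∞) :
    -- random backward trajectories exist for every starting point
    (∀ y₀ : ShiftSpace M, ∃ ℙ : Measure (ℕ → ShiftSpace M),
      IsRandomBackwardTrajectory (shift M) y₀ ℙ (fun n y => y n)) ∧
    -- (a) positive recurrent case
    (IsPositiveRecurrent (backwardMatrix M) →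
      ∃ π : I → ℝ≥0∞, IsStationaryVector π (backwardMatrix M) ∧
        (∀ π' : I → ℝ≥0∞, IsStationaryVector π' (backwardMatrix M) → π' = π) ∧
        (∀ i, 0 < π i) ∧
        ∃ P : Matrix I I ℝ≥0∞, (∀ i, ∑' j, P i j = 1) ∧
          (∀ i j, π i * P i j = π j * backwardMatrix M j i) ∧
          ∃ μ : Measure (ShiftSpace M), IsMarkovMeasure M μ π P ∧
            IsFairMeasure (shift M) (oneCylinder M) μ ∧
            ∀ (y₀ : ShiftSpace M) {Ω : Type*} [MeasurableSpace Ω] (ℙ : Measure Ω)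
              (Y : ℕ → Ω → ShiftSpace M), IsRandomBackwardTrajectory (shift M) y₀ ℙ Y →
              ∀ᵐ ω ∂ℙ, Equidistributes (fun n => Y n ω) μ) ∧
    -- (b) null recurrent case
    (IsNullRecurrent (backwardMatrix M) →
      ∀ (y₀ : ShiftSpace M) {Ω : Type*} [MeasurableSpace Ω] (ℙ : Measure Ω)
        (Y : ℕ → Ω → ShiftSpace M), IsRandomBackwardTrajectory (shift M) y₀ ℙ Y →
        ∀ᵐ ω ∂ℙ, Dense (Set.range fun n => Y n ω) ∧
          ∀ i, HasLimitingFrequency (fun n => Y n ω) (oneCylinder M i) 0) ∧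
    -- (c) transient case
    (IsTransient (backwardMatrix M) →
      ∀ (y₀ : ShiftSpace M) {Ω : Type*} [MeasurableSpace Ω] (ℙ : Measure Ω)
        (Y : ℕ → Ω → ShiftSpace M), IsRandomBackwardTrajectory (shift M) y₀ ℙ Y →
        ∀ᵐ ω ∂ℙ, ∀ i, {n : ℕ | Y n ω ∈ oneCylinder M i}.Finite) := by
  have hpred := exists_predecessor hstates htrans
  have hQ := isStochastic_backwardMatrix hpred hcol
  have hirr := isIrreducibleChain_backwardMatrix hstates htrans hcol
  obtain ⟨a⟩ := ‹Nonempty I›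
  refine ⟨exists_isRandomBackwardTrajectory hM hQ, fun hpr => ?_, fun hnr y₀ Ω _ ℙ Y hY => ?_,
    fun htr y₀ Ω _ ℙ Y hY => hY.ae_finite_visits hM hQ htr⟩
  · have ha : hitProb (backwardMatrix M) a a = 1 := (hpr a).1
    have hπ := isStationaryVector_statVec hQ ha (hpr a).2
    have hpos := statVec_pos hirr ha (hpr a).2
    have hP := isStochastic_reversedMatrix hπ hpos
    have hrev := mul_reversedMatrix hπ hpos
    obtain ⟨μ, hμ⟩ := exists_isMarkovMeasure (M := M) hπ.1 hP fun i j hij => by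
      rw [reversedMatrix, backwardMatrix_of_ne_one hM hij, mul_zero, ENNReal.zero_div]
    exact ⟨_, hπ, fun π' hπ' => eq_statVec hQ hirr ha hπ'.1 fun y => (hπ'.2 y).le, hpos, _, hP,
      hrev, μ, hμ, hμ.isFairMeasure hπ.1 hM hQ hrev,
      fun y₀ Ω _ ℙ Y hY => hY.ae_equidistributes hM hQ hirr ha hπ hpos hrev hμ⟩
  · have hhit : ∀ j x, hitProb (backwardMatrix M) j x = 1 := fun j x =>
      hitProb_eq_one hQ hirr (hnr j).1 x
    filter_upwards [hY.ae_dense hM hcol hQ hhit,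
      hY.ae_hasLimitingFrequency_zero hM hQ hirr (hnr a).1 (hnr a).2] with ω h1 h2
    exact ⟨h1, h2⟩
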